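/- Let $1\le m$ and $n$ be integers, let $\varepsilon_0,b>0$, and let $M$ be a closed (compact, Hausdorff, without boundary, not necessarily connected) $m$-dimensional manifold of class $C^2$. **The space of submanifolds.** Let $\mathrm{Imm}^2(M,\mathbb R^n)$ be the set of $C^2$ immersions $f\colon M\to\mathbb R^n$ with the compact-open $C^2$ topology (uniform closeness in charts, on compact sets, of the maps and of all their partial derivatives of order at most $2$). An immersed submanifold parametrized by $M$ is an element $[f]$ of the quotient space $\mathrm{Imm}^2(M,\mathbb R^n)/\mathrm{Diff}^2(M)$ with the quotient topology (the $C^2$-topology); it is embedded if $f$ is an embedding, and it has a double point if $f(p)=f(p')$ for some $p\ne p'$. **The class $\mathcal M(2,\varepsilon_0,b,\infty)$** consists of those $[f]$ such that for every $x\in f(M)$ the preimage $f^{-1}(B_{\varepsilon_0}(x))$ of the open ball of radius $\varepsilon_0$ is a disjoint union of finitely many open sets $W_1,\dots,W_\ell$, each $W_i$ is $C^2$-diffeomorphic to an open $m$-ball, $f|_{W_i}$ is a $C^2$-diffeomorphism onto $f(W_i)$, and each $f(W_i)$ that contains $x$ is, in coordinates with origin $x$, the graph of a $C^2$ function $h_i\colon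 U_i\to (T_xf(W_i))^\perp$, $U_i\subset T_xf(W_i)$ open, with $|\partial^\mu h_i|\le b$ on $U_i$ for all orthogonal axes of $T_xf(W_i)$ and all multi-indices $0\le|\mu|\le2$. (There is no bound on the volume.) **The energy.** Let $N=f(M)\subset\mathbb R^n$ be an embedded submanifold with an orientation. For distinct $x,y\in N$ let $\Sigma_x(y)$ be the $m$-sphere (an $m$-plane if $y\in x+T_xN$) that is tangent to $N$ at $x$ and passes through $y$, with the orientation that agrees with that of $N$ at $x$. Let $u_1,\dots,u_m$ and $v_1,\dots,v_m$ be positively oriented orthonormal bases of $T_y\Sigma_x(y)$ and $T_yN$. The combined angle $\theta_N(x,y)$ is given by $\cos\theta_N(x,y)=\det(\langle u_i,v_j\rangle)$, and the Kusner–Sullivan energy is $$E_{KS}(N)=\iint_{N\times N}\frac{(1-\cos\theta_N(x,y))^m}{|x-y|^{2m}}\,dx\,dy\in[0,\infty],$$ where $dx$, $dy$ are the $m$-dimensional volume. **Theorem.** $E_{KS}$ is self-repulsive on $\mathcal M(2,\varepsilon_0,b,\infty)$ with respect to the $C^2$-topology: if $N_\infty\in\mathcal M(2,\varepsilon_0,b,\infty)$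 is an immersed submanifold parametrized by $M$ that has a double point (transversal or tangential), then for every $C\ge 0$ there is a neighbourhood $\mathcal U$ of $N_\infty$ in $\mathrm{Imm}^2(M,\mathbb R^n)/\mathrm{Diff}^2(M)$ such that $E_{KS}(N)>C$ for every embedded submanifold $N\in\mathcal U$ and every orientation of $N$. In particular, if embedded $C^2$ submanifolds $N_k$ converge to $N_\infty$ in the $C^2$-topology, then $E_{KS}(N_k)\to\infty$. -/

import Mathlib

open Set Filter Topology MeasureTheory
open scoped Manifold ContDiff ENNReal NNReal

namespace KusnerSullivan

noncomputable section

/-- Euclidean space `ℝ^n`. -/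
abbrev Eu (n : ℕ) : Type := EuclideanSpace ℝ (Fin n)

/-! ### The weak `C^q` topology -/

/-- The partial derivative `∂^μ F (x)` of order `j`, where the multi-index `μ` lists the coordinate
directions `s 0, …, s (j-1)` with repetitions. -/
def partialDeriv {m n j : ℕ} (s : Fin j → Fin m) (F : Eu m → Eu n) (x : Eu m) : Eu n :=
  iteratedFDeriv ℝ j F x (fun i => EuclideanSpace.single (s i) (1 : ℝ))

section Weak

variable {m n : ℕ} (k : WithTop ℕ∞) (q : ℕ)
  (M : Type*) [TopologicalSpace M] [ChartedSpace (Eu m) M]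
  (N : Type*) [TopologicalSpace N] [ChartedSpace (Eu n) N]

variable {k M N} in
/-- The set of all `g` with `g(K) ⊆ V` whose local expression `ψ g φ⁻¹` is `ε`-close to `ψ f φ⁻¹`
on `φ(K)`, together with all partial derivatives of order at most `q`. -/
def weakNhd (f : C^k⟮𝓡 m, M; 𝓡 n, N⟯) (φ : OpenPartialHomeomorph M (Eu m))
    (ψ : OpenPartialHomeomorph N (Eu n)) (K : Set M) (ε : ℝ) : Set C^k⟮𝓡 m, M; 𝓡 n, N⟯ :=
  {g | MapsTo g K ψ.source ∧ ∀ x ∈ φ '' K, ∀ j ≤ q, ∀ s : Fin j → Fin m,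
    ‖partialDeriv s (ψ ∘ g ∘ φ.symm) x - partialDeriv s (ψ ∘ f ∘ φ.symm) x‖ < ε}

/-- The compact-open `C^q` topology (weak topology) on `C^k(M, N)`. -/
abbrev weakTopology : TopologicalSpace C^k⟮𝓡 m, M; 𝓡 n, N⟯ :=
  TopologicalSpace.generateFrom
    {𝒩 | ∃ (f : C^k⟮𝓡 m, M; 𝓡 n, N⟯) (φ : OpenPartialHomeomorph M (Eu m))
        (ψ : OpenPartialHomeomorph N (Eu n)) (K : Set M) (ε : ℝ),
      φ ∈ IsManifold.maximalAtlas (𝓡 m) k M ∧ ψ ∈ IsManifold.maximalAtlas (𝓡 n) k N ∧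
      IsCompact K ∧ K ⊆ φ.source ∧ MapsTo f K ψ.source ∧ 0 < ε ∧
      𝒩 = weakNhd q f φ ψ K ε}

end Weak

/-! ### The space of immersed submanifolds -/

section Immersions

/-- The space `Imm^k_q(M, ℝ^n)` of `C^k` immersions of the `m`-manifold `M` into `ℝ^n`; the index `q`
records that it carries the `C^q` topology. -/
def Imm (m n : ℕ) (k : WithTop ℕ∞) (_q : ℕ)
    (M : Type*) [TopologicalSpace M] [ChartedSpace (Eu m) M] : Type _ :=
  {f : C^k⟮𝓡 m, M; 𝓡 n, Eu n⟯ // ∀ p, Function.Injective (mfderiv (𝓡 m) (𝓡 n) f p)}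

variable (m n : ℕ) (k : WithTop ℕ∞) (q : ℕ)
  (M : Type*) [TopologicalSpace M] [ChartedSpace (Eu m) M]

instance : TopologicalSpace (Imm m n k q M) :=
  (weakTopology k q M (Eu n)).induced Subtype.val

instance : CoeFun (Imm m n k q M) (fun _ => M → Eu n) := ⟨fun f => f.1⟩

/-- Two immersions are equivalent if they differ by a `C^k` diffeomorphism of `M`. -/
instance immSetoid : Setoid (Imm m n k q M) where
  r f g := ∃ φ : M ≃ₘ^k⟮𝓡 m, 𝓡 m⟯ M, ∀ p, g p = f (φ p)
  iseqv :=
    { refl := fun _ => ⟨Diffeomorph.refl (𝓡 m) M k, fun _ => rfl⟩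
      symm := by
        rintro f g ⟨φ, h⟩
        exact ⟨φ.symm, fun p => by rw [h, Diffeomorph.apply_symm_apply]⟩
      trans := by
        rintro f g l ⟨φ, h⟩ ⟨χ, h'⟩
        exact ⟨χ.trans φ, fun p => by rw [h', h]; rfl⟩ }

/-- The space `Imm^k_q(M, ℝ^n) / Diff^k(M)` of immersed submanifolds of `ℝ^n` that are parametrized
by `M`, with the quotient of the `C^q` topology. The space of all closed immersed submanifolds is
the topological disjoint union of these spaces over the diffeomorphism types of closed `M`, so a
neighbourhood of a point parametrized by `M` may be taken in the space belonging to `M`. -/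
abbrev ImmSubmfd : Type _ := Quotient (immSetoid m n k q M)

end Immersions

section Geometry

variable {m n : ℕ} {k : WithTop ℕ∞} {q : ℕ}
  {M : Type*} [TopologicalSpace M] [ChartedSpace (Eu m) M]

/-- The immersed submanifold has a double point. -/
def HasDoublePoint (N : ImmSubmfd m n k q M) : Prop :=
  ∃ f : Imm m n k q M, ⟦f⟧ = N ∧ ∃ p p' : M, p ≠ p' ∧ f p = f p'

/-- The tangent plane `df(T_p M)`, a linear subspace of `ℝ^n`. -/
def tangentPlane (f : M → Eu n) (p : M) : Submodule ℝ (Eu n) :=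
  LinearMap.range (mfderiv (𝓡 m) (𝓡 n) f p).toLinearMap

/-- `f` restricts to a `C^k` diffeomorphism from the set `s` onto the set `t`. -/
def IsDiffeoOn {m₁ m₂ : ℕ} (k : WithTop ℕ∞)
    {M₁ : Type*} [TopologicalSpace M₁] [ChartedSpace (Eu m₁) M₁]
    {M₂ : Type*} [TopologicalSpace M₂] [ChartedSpace (Eu m₂) M₂]
    (f : M₁ → M₂) (s : Set M₁) (t : Set M₂) : Prop :=
  ContMDiffOn (𝓡 m₁) (𝓡 m₂) k f s ∧ MapsTo f s t ∧
    ∃ g : M₂ → M₁, ContMDiffOn (𝓡 m₂) (𝓡 m₁) k g t ∧ MapsTo g t s ∧ InvOn g f s t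

/-- The set `W' ∋ x` is the graph, in the coordinates with origin `x`, of a `C^k` function
`h : U → Tᗮ`, `U ⊆ T` open, all of whose partial derivatives of order `0 ≤ |μ| ≤ k` with respect to
any orthogonal axes of `T` are bounded by `b` on `U`. -/
def IsBoundedGraph (k : WithTop ℕ∞) (b : ℝ) (x : Eu n) (T : Submodule ℝ (Eu n))
    (W' : Set (Eu n)) : Prop :=
  ∃ (U : Set T) (h : T → Tᗮ), IsOpen U ∧ ContDiffOn ℝ k h U ∧
    W' = (fun η : T => x + ((η : Eu n) + (h η : Eu n))) '' U ∧
    ∀ (e : OrthonormalBasis (Fin (Module.finrank ℝ T)) ℝ T) (j : ℕ), (j : WithTop ℕ∞) ≤ k →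
      ∀ (s : Fin j → Fin (Module.finrank ℝ T)), ∀ η ∈ U,
        ‖iteratedFDeriv ℝ j h η (fun i => e (s i))‖ ≤ b

/-- The volume of the immersed submanifold `f(M)`, counted with multiplicity. -/
def immVolume (m : ℕ) {n : ℕ} {M : Type*} (f : M → Eu n) : ℝ≥0∞ :=
  ∫⁻ y, ((f ⁻¹' {y}).encard : ℝ≥0∞) ∂(μHE[m] : Measure (Eu n))

/-- The class `𝓜(k, ε₀, b, V)` of closed immersed submanifolds of bounded geometry (here those that
are parametrized by `M`). For every point `x` of the submanifold the preimage of the ball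
`B_{ε₀}(x)` is a disjoint union of finitely many sets `W i` that are `C^k` diffeomorphic to an
`m`-ball and mapped `C^k` diffeomorphically onto their images, and every image `f '' W i` through `x`
is a graph over its tangent plane at `x` of a function with derivatives bounded by `b`. -/
def boundedGeometry (m n : ℕ) (k : WithTop ℕ∞) (q : ℕ)
    (M : Type*) [TopologicalSpace M] [ChartedSpace (Eu m) M]
    (ε₀ b : ℝ) (V : ℝ≥0∞) : Set (ImmSubmfd m n k q M) :=
  {N | ∃ f : Imm m n k q M, ⟦f⟧ = N ∧ immVolume m f ≤ V ∧
    ∀ x ∈ range f, ∃ (l : ℕ) (W : Fin l → Set M),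
      f ⁻¹' Metric.ball x ε₀ = ⋃ i, W i ∧
      Pairwise (fun i j => Disjoint (W i) (W j)) ∧
      ∀ i, IsOpen (W i) ∧
        (∃ φ : Eu m → M, IsDiffeoOn (m₁ := m) (m₂ := m) k φ (Metric.ball 0 1) (W i)) ∧
        IsDiffeoOn (m₁ := m) (m₂ := n) k f (W i) (f '' W i) ∧
        ∀ p ∈ W i, f p = x → IsBoundedGraph k b x (tangentPlane (m := m) f p) (f '' W i)}

/-! ### Orientations, the combined angle and the energy -/

/-- An orientation of the manifold `M`: an orientation of every tangent space which is locally
constant with respect to the coordinate changes of the tangent bundle. -/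
structure MfdOrientation (m : ℕ) (M : Type*) [TopologicalSpace M] [ChartedSpace (Eu m) M]
    [IsManifold (𝓡 m) 1 M] where
  at_ : ∀ p : M, Orientation ℝ (TangentSpace (𝓡 m) p) (Fin m)
  locallyConst : ∀ p : M, ∀ᶠ p' in 𝓝 p,
    ∀ (v : Module.Basis (Fin m) ℝ (TangentSpace (𝓡 m) p))
      (w : Module.Basis (Fin m) ℝ (TangentSpace (𝓡 m) p')),
      (∀ i, w i = tangentCoordChange (𝓡 m) p p' p' (v i)) →
        (v.orientation = at_ p ↔ w.orientation = at_ p')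

/-- The matrix `(⟨a i, b j⟩)`. -/
def gram {r n : ℕ} (a b : Fin r → Eu n) : Matrix (Fin r) (Fin r) ℝ :=
  Matrix.of fun i j => inner ℝ (a i) (b j)

/-- `v` is a positively oriented ordered orthonormal basis of the tangent space at the point `x` of
the embedded oriented submanifold `f(M)`. -/
def IsPosFrame [IsManifold (𝓡 m) 1 M] (f : M → Eu n) (o : MfdOrientation m M) (x : Eu n)
    (v : Fin m → Eu n) : Prop :=
  Orthonormal ℝ v ∧ ∃ p : M, f p = x ∧
    ∃ β : Module.Basis (Fin m) ℝ (TangentSpace (𝓡 m) p), β.orientation = o.at_ p ∧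
      ∀ i, v i = mfderiv (𝓡 m) (𝓡 n) f p (β i)

/-- Let `a` be an ordered orthonormal basis of an `m`-plane `T`, and let `Σ` be the `m`-sphere that
is tangent to `x + T` at `x` and passes through `y`, with the orientation that agrees at `x` with the
one of `a`. Then `u` is a positively oriented ordered orthonormal basis of `T_y Σ`.

If `y - x ∈ T`, then `Σ` is the plane `x + T` (a sphere through infinity). Otherwise `Σ` is the
sphere with centre `c` and radius `|x - c| = |y - c|` in the affine `(m+1)`-space
`x + T + ℝ (y - x)`, where `c - x ⊥ T`; the orientations of `T_x Σ` and `T_y Σ` correspond to each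
other iff the bases `(x - c, a)` and `(y - c, u)`, obtained by prefixing the radial vectors, give
this `(m+1)`-space the same orientation. Two bases of a Euclidean space have the same orientation
iff the determinant of their mixed Gram matrix is positive. -/
def IsPosSphereFrame (x : Eu n) (a : Fin m → Eu n) (y : Eu n) (u : Fin m → Eu n) : Prop :=
  Orthonormal ℝ u ∧
    ((y - x ∈ Submodule.span ℝ (range a) ∧
        (∀ i, u i ∈ Submodule.span ℝ (range a)) ∧ 0 < (gram a u).det) ∨
      (y - x ∉ Submodule.span ℝ (range a) ∧
        ∃ c : Eu n, (c - x ∈ Submodule.span ℝ (insert (y - x) (range a))) ∧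
          (∀ i, inner ℝ (a i) (c - x) = 0) ∧ dist x c = dist y c ∧
          (∀ i, u i ∈ Submodule.span ℝ (insert (y - x) (range a))) ∧
          (∀ i, inner ℝ (u i) (y - c) = 0) ∧
          0 < (gram (Fin.cons (x - c) a : Fin (m + 1) → Eu n) (Fin.cons (y - c) u)).det))

/-- The cosine of the combined angle `θ_M(x, y)`: the number `det (⟨u i, v j⟩)`, which is the same
for all positive orthonormal bases `u` of `T_y Σ_x(y)` and `v` of `T_y M`. -/
def cosCombinedAngle [IsManifold (𝓡 m) 1 M] (f : M → Eu n) (o : MfdOrientation m M)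
    (x y : Eu n) : ℝ :=
  Classical.epsilon fun t : ℝ => ∃ a u v : Fin m → Eu n,
    IsPosFrame f o x a ∧ IsPosSphereFrame x a y u ∧ IsPosFrame f o y v ∧ t = (gram u v).det

/-- The Kusner–Sullivan energy of the embedded submanifold `f(M)` with the orientation `o`. -/
def energy [IsManifold (𝓡 m) 1 M] (f : M → Eu n) (o : MfdOrientation m M) : ℝ≥0∞ :=
  ∫⁻ x in range f, ∫⁻ y in range f,
    ENNReal.ofReal ((1 - cosCombinedAngle f o x y) ^ m / dist x y ^ (2 * m))
    ∂(μHE[m] : Measure (Eu n)) ∂(μHE[m] : Measure (Eu n))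

/-- A functional `E` of oriented embedded submanifolds is self-repulsive on the class `𝒞` with
respect to the `C^q` topology: if an immersed submanifold `N₀` in `𝒞` has a double point, then `E`
blows up as an embedded submanifold (with any orientation) approaches `N₀`. -/
def SelfRepulsiveOn [IsManifold (𝓡 m) 1 M]
    (E : (M → Eu n) → MfdOrientation m M → ℝ≥0∞) (𝒞 : Set (ImmSubmfd m n k q M)) : Prop :=
  ∀ N₀ ∈ 𝒞, HasDoublePoint N₀ → ∀ C : ℝ≥0, ∀ᶠ N in 𝓝 N₀,
    ∀ g : Imm m n k q M, ⟦g⟧ = N → IsEmbedding g → ∀ o : MfdOrientation m M, (C : ℝ≥0∞) < E g o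

end Geometry

end

end KusnerSullivan

/-!
The reflection in the hyperplane bisecting `x` and `y` carries positive frames of `T_xN` to frames
of the tangent sphere `Σ_x(y)` at `y` and reverses their orientation, so `cos θ_N(x, y)` equals
`-det ⟨R aᵢ, vⱼ⟩` for the linear reflection `R` along the chord `y - x`.

At a double point an embedded `N` close to `N_∞` has two disjoint sheets through a ball of fixed
radius `r` that are `C¹` close to `m`-planes `A` and `B`; let `ε` measure the closeness.

* If `A ≠ B`, take a chord in a direction `e` of `A`. Then `R` preserves `A`, and `|cos θ|` is close
  to `|det ⟨aᵢ, bⱼ⟩| < 1` for orthonormal frames of `A` and `B`. By scaling, the pairs of points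
  displaced by `r / 2 ^ i` along `e` contribute the same amount for every `i` such that `r / 2 ^ i`
  is large compared with `εr`, and the number of these `i` tends to infinity as `ε → 0`.
* If `A = B`, every point `x` near the centre of one sheet has a normal distance `u ≤ 4εr` to the
  other sheet. There is a patch of that sheet of radius comparable to `u` on which `cos θ ≤ 0`: if
  the sheets are equally oriented it lies at the foot point of `x`, where `R` is the identity on
  `A`; otherwise it lies at a tangential distance that is a large multiple of `u`, where `R` almost
  reflects `A` in itself. So the inner integral is at least a constant times `u ^ m / u ^ (2 * m)`,
  which blows up as `ε → 0`.
-/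

namespace KusnerSullivan

noncomputable section

section Gram

variable {n r : ℕ}

theorem gram_apply (a b : Fin r → Eu n) (i j : Fin r) : gram a b i j = inner ℝ (a i) (b j) := rfl

theorem gram_transpose (a b : Fin r → Eu n) : (gram a b).transpose = gram b a := by
  ext i j
  exact real_inner_comm (b i) (a j)

theorem det_gram_comm (a b : Fin r → Eu n) : (gram a b).det = (gram b a).det := by
  rw [← gram_transpose, Matrix.det_transpose]

theorem gram_self_eq_one {a : Fin r → Eu n} (ha : Orthonormal ℝ a) : gram a a = 1 := by
  ext i j
  rw [gram_apply, orthonormal_iff_ite.1 ha i j, Matrix.one_apply]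

theorem gram_mul_gram {b p : Fin r → Eu n} (hb : Orthonormal ℝ b)
    (hp : ∀ i, p i ∈ Submodule.span ℝ (range b)) (q : Fin r → Eu n) :
    gram p b * gram b q = gram p q := by
  ext i j
  obtain ⟨c, hc⟩ := (Submodule.mem_span_range_iff_exists_fun ℝ).1 (hp i)
  simp only [Matrix.mul_apply, gram_apply, ← hc, hb.inner_left_fintype, sum_inner,
    real_inner_smul_left, conj_trivial]

theorem det_gram_sq_eq_one {a b : Fin r → Eu n} (ha : Orthonormal ℝ a) (hb : Orthonormal ℝ b)
    (h : ∀ i, a i ∈ Submodule.span ℝ (range b)) : (gram a b).det ^ 2 = 1 := by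
  rw [sq]
  nth_rw 2 [det_gram_comm]
  rw [← Matrix.det_mul, gram_mul_gram hb h, gram_self_eq_one ha, Matrix.det_one]

theorem det_gram_cons {p : Eu n} {u : Fin r → Eu n} (h : ∀ j, inner ℝ p (u j) = (0 : ℝ)) (q : Eu n)
    (b : Fin r → Eu n) :
    (gram (Fin.cons p b : Fin (r + 1) → Eu n) (Fin.cons q u)).det =
      inner ℝ p q * (gram b u).det := by
  rw [Matrix.det_succ_row_zero, Fin.sum_univ_succ, Finset.sum_eq_zero fun j _ => by
    rw [gram_apply, Fin.cons_zero, Fin.cons_succ, h, mul_zero, zero_mul]]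
  simp only [Fin.val_zero, pow_zero, one_mul, add_zero, Fin.succAbove_zero]
  rfl

end Gram

section Reflection

variable {E : Type*} [NormedAddCommGroup E] [InnerProductSpace ℝ E]

/-- The reflection in the hyperplane orthogonal to `w` (the identity if `w = 0`). For `w = y - x` it
carries the planes tangent at `x` to those that are tangent at `y` to the same spheres through `x`
and `y`. -/
def hyperplaneReflection (w : E) : E ≃ₗᵢ[ℝ] E := (ℝ ∙ w)ᗮ.reflection

theorem hyperplaneReflection_apply (w z : E) :
    hyperplaneReflection w z = z - (2 * inner ℝ w z / ‖w‖ ^ 2) • w := by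
  rw [hyperplaneReflection, Submodule.reflection_orthogonal_apply,
    Submodule.reflection_singleton_apply, RCLike.ofReal_real_eq_id, id, neg_sub, two_smul,
    ← add_smul]
  congr 2
  ring

theorem hyperplaneReflection_hyperplaneReflection (w z : E) :
    hyperplaneReflection w (hyperplaneReflection w z) = z :=
  Submodule.reflection_reflection _ z

theorem hyperplaneReflection_sub {v w : E} (h : ‖v‖ = ‖w‖) : hyperplaneReflection (v - w) v = w :=
  Submodule.reflection_sub h

theorem hyperplaneReflection_smul {t : ℝ} (ht : t ≠ 0) (w : E) :
    hyperplaneReflection (t • w) = hyperplaneReflection w := by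
  simp only [hyperplaneReflection, Submodule.span_singleton_smul_eq ht.isUnit]

theorem inner_hyperplaneReflection_left (w p q : E) :
    inner ℝ (hyperplaneReflection w p) q = inner ℝ p (hyperplaneReflection w q) := by
  rw [← (hyperplaneReflection w).inner_map_map, hyperplaneReflection_hyperplaneReflection]

theorem hyperplaneReflection_mem {T : Submodule ℝ E} {w z : E} (hw : w ∈ T) (hz : z ∈ T) :
    hyperplaneReflection w z ∈ T := by
  rw [hyperplaneReflection_apply]
  exact T.sub_mem hz (T.smul_mem _ hw)

theorem coe_hyperplaneReflection {T : Submodule ℝ E} (w z : T) :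
    (hyperplaneReflection w z : E) = hyperplaneReflection (w : E) z := by
  simp only [hyperplaneReflection_apply, Submodule.coe_sub, Submodule.coe_smul, Submodule.coe_inner,
    Submodule.coe_norm]

theorem det_hyperplaneReflection [FiniteDimensional ℝ E] {w : E} (hw : w ≠ 0) :
    LinearMap.det (hyperplaneReflection w).toLinearEquiv.toLinearMap = -1 := by
  rw [hyperplaneReflection, Submodule.det_reflection, Submodule.orthogonal_orthogonal,
    finrank_span_singleton hw, pow_one]

variable {n r : ℕ}

theorem gram_hyperplaneReflection_comp_left (w : Eu n) (p q : Fin r → Eu n) :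
    gram (hyperplaneReflection w ∘ p) q = gram p (hyperplaneReflection w ∘ q) := by
  ext i j
  exact inner_hyperplaneReflection_left w (p i) (q j)

theorem det_gram_hyperplaneReflection_comp_orthonormalBasis {T : Submodule ℝ (Eu n)}
    (b : OrthonormalBasis (Fin r) ℝ T) {w : T} (hw : w ≠ 0) :
    (gram (fun i => (b i : Eu n)) (hyperplaneReflection (w : Eu n) ∘ fun i => (b i : Eu n))).det =
      -1 := by
  rw [← det_hyperplaneReflection hw, ← LinearMap.det_toMatrix b.toBasis]
  congr 1
  ext i j
  rw [LinearMap.toMatrix_apply, b.coe_toBasis_repr_apply, b.repr_apply_apply, b.coe_toBasis]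
  exact congrArg (inner ℝ (b i : Eu n)) (coe_hyperplaneReflection w (b j)).symm

theorem det_gram_hyperplaneReflection_comp_left {T : Submodule ℝ (Eu n)}
    (hT : Module.finrank ℝ T = r) {w : Eu n} (hw : w ≠ 0) (hwT : w ∈ T) {p : Fin r → Eu n}
    (hp : ∀ i, p i ∈ T) (q : Fin r → Eu n) :
    (gram (hyperplaneReflection w ∘ p) q).det = -(gram p q).det := by
  let b : OrthonormalBasis (Fin r) ℝ T := (stdOrthonormalBasis ℝ T).reindex (finCongr hT)
  have hb : Orthonormal ℝ fun i => (b i : Eu n) :=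
    b.orthonormal.comp_linearIsometry T.subtypeₗᵢ
  have hmem {z : Fin r → Eu n} (hz : ∀ i, z i ∈ T) (i) :
      z i ∈ Submodule.span ℝ (range fun i => (b i : Eu n)) := by
    have := Submodule.mem_map_of_mem (f := T.subtype) (b.toBasis.mem_span ⟨z i, hz i⟩)
    rwa [← Submodule.span_image, ← range_comp, b.coe_toBasis] at this
  have hRp (i) : (hyperplaneReflection w ∘ p) i ∈ T := hyperplaneReflection_mem hwT (hp i)
  have hRb := det_gram_hyperplaneReflection_comp_orthonormalBasis b (w := ⟨w, hwT⟩)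
    (by simpa using hw)
  rw [← gram_mul_gram hb (hmem hRp) q, gram_hyperplaneReflection_comp_left,
    ← gram_mul_gram hb (hmem hp), Matrix.det_mul, Matrix.det_mul, hRb, mul_neg_one, neg_mul,
    ← Matrix.det_mul, gram_mul_gram hb (hmem hp)]

theorem det_gram_hyperplaneReflection_comp_self {b : Fin r → Eu n} (hb : Orthonormal ℝ b) {w : Eu n}
    (hw : w ≠ 0) (hwb : w ∈ Submodule.span ℝ (range b)) :
    (gram b (hyperplaneReflection w ∘ b)).det = -1 := by
  rw [det_gram_comm, det_gram_hyperplaneReflection_comp_left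
    ((finrank_span_eq_card hb.linearIndependent).trans (Fintype.card_fin r)) hw hwb
    (fun i => Submodule.subset_span (mem_range_self i)), gram_self_eq_one hb, Matrix.det_one]

end Reflection

section Sphere

variable {m n : ℕ} {x y c : Eu n} {a u : Fin m → Eu n}

theorem finrank_span_insert_range (ha : LinearIndependent ℝ a) {w : Eu n}
    (hw : w ∉ Submodule.span ℝ (range a)) :
    Module.finrank ℝ (Submodule.span ℝ (insert w (range a))) = m + 1 := by
  rw [← Fin.range_cons, finrank_span_eq_card (linearIndependent_finCons.2 ⟨ha, hw⟩),
    Fintype.card_fin]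

theorem hyperplaneReflection_centre (hc : dist x c = dist y c) :
    hyperplaneReflection (y - x) (y - c) = x - c := by
  rw [← sub_sub_sub_cancel_right y x c]
  exact hyperplaneReflection_sub (by rw [← dist_eq_norm, ← dist_eq_norm, hc])

theorem inner_sub_centre_ne_zero (hxy : x ≠ y) (hc : dist x c = dist y c) :
    inner ℝ (y - x) (x - c) ≠ (0 : ℝ) := by
  have h : ‖y - x + (x - c)‖ = ‖x - c‖ := by
    rw [sub_add_sub_cancel, ← dist_eq_norm, ← dist_eq_norm, hc]
  have hpos : 0 < ‖y - x‖ := norm_pos_iff.2 (sub_ne_zero.2 hxy.symm)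
  have := norm_add_sq_real (y - x) (x - c)
  rw [h] at this
  nlinarith

theorem inner_hyperplaneReflection_centre (hc : dist x c = dist y c) (z : Eu n) :
    inner ℝ (hyperplaneReflection (y - x) z) (x - c) = inner ℝ z (y - c) := by
  rw [← hyperplaneReflection_centre hc, LinearIsometryEquiv.inner_map_map]

theorem mem_span_iff_inner_centre_eq_zero (hxy : x ≠ y)
    (hca : ∀ i, inner ℝ (a i) (c - x) = (0 : ℝ)) (hc : dist x c = dist y c) {z : Eu n}
    (hz : z ∈ Submodule.span ℝ (insert (y - x) (range a))) :
    z ∈ Submodule.span ℝ (range a) ↔ inner ℝ z (x - c) = (0 : ℝ) := by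
  have hspan {z} (hz : z ∈ Submodule.span ℝ (range a)) : inner ℝ z (x - c) = (0 : ℝ) := by
    obtain ⟨k, rfl⟩ := (Submodule.mem_span_range_iff_exists_fun ℝ).1 hz
    rw [sum_inner]
    refine Finset.sum_eq_zero fun i _ => ?_
    rw [real_inner_smul_left, ← neg_sub c x, inner_neg_right, hca, neg_zero, mul_zero]
  refine ⟨hspan, fun hzc => ?_⟩
  obtain ⟨t, z', hz', rfl⟩ := Submodule.mem_span_insert.1 hz
  rw [inner_add_left, hspan hz', add_zero, real_inner_smul_left] at hzc
  obtain rfl := (mul_eq_zero.1 hzc).resolve_right (inner_sub_centre_ne_zero hxy hc)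
  rwa [zero_smul, zero_add]

theorem exists_centre (hyx : y - x ∉ Submodule.span ℝ (range a)) :
    ∃ c, c - x ∈ Submodule.span ℝ (insert (y - x) (range a)) ∧
      (∀ i, inner ℝ (a i) (c - x) = (0 : ℝ)) ∧ dist x c = dist y c := by
  set T := Submodule.span ℝ (range a)
  obtain ⟨p, hp, ν, hν, hpν⟩ := T.exists_add_mem_mem_orthogonal (y - x)
  have hν0 : ‖ν‖ ≠ 0 := norm_ne_zero_iff.2 fun h => hyx (by rwa [hpν, h, add_zero])
  have hpE : p ∈ Submodule.span ℝ (insert (y - x) (range a)) :=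
    Submodule.span_mono (subset_insert _ _) hp
  have hνE : ν ∈ Submodule.span ℝ (insert (y - x) (range a)) := by
    rw [← add_sub_cancel_left p ν, ← hpν]
    exact Submodule.sub_mem _ (Submodule.subset_span (mem_insert _ _)) hpE
  have hinner : inner ℝ (y - x) ν = ‖ν‖ ^ 2 := by
    rw [hpν, inner_add_left, hν p hp, zero_add, real_inner_self_eq_norm_sq]
  refine ⟨x + (‖y - x‖ ^ 2 / (2 * ‖ν‖ ^ 2)) • ν, ?_, fun i => ?_, ?_⟩
  · rw [add_sub_cancel_left]
    exact Submodule.smul_mem _ _ hνE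
  · rw [add_sub_cancel_left, real_inner_smul_right,
      hν _ (Submodule.subset_span (mem_range_self i)), mul_zero]
  · rw [dist_self_add_right, dist_eq_norm, ← sub_sub, eq_comm,
      ← pow_left_inj₀ (norm_nonneg _) (norm_nonneg _) two_ne_zero, norm_sub_sq_real,
      real_inner_smul_right, hinner, add_eq_right]
    field_simp
    ring

theorem det_gram_cons_radial (ha : Orthonormal ℝ a)
    (hyx : y - x ∉ Submodule.span ℝ (range a))
    (hcE : c - x ∈ Submodule.span ℝ (insert (y - x) (range a))) (hc : dist x c = dist y c)
    (huc : ∀ i, inner ℝ (u i) (y - c) = (0 : ℝ)) :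
    (gram (Fin.cons (x - c) a : Fin (m + 1) → Eu n) (Fin.cons (y - c) u)).det =
      -(‖y - c‖ ^ 2 * (gram a (hyperplaneReflection (y - x) ∘ u)).det) := by
  have hw : y - x ≠ 0 := fun h => hyx (h ▸ zero_mem _)
  have hmem : ∀ i, (Fin.cons (x - c) a : Fin (m + 1) → Eu n) i ∈
      Submodule.span ℝ (insert (y - x) (range a)) :=
    Fin.cases (by simpa using neg_mem hcE) fun i =>
      Submodule.subset_span (mem_insert_of_mem _ (mem_range_self i))
  have hR : hyperplaneReflection (y - x) ∘ (Fin.cons (x - c) a : Fin (m + 1) → Eu n) =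
      Fin.cons (y - c) (hyperplaneReflection (y - x) ∘ a) := by
    rw [← hyperplaneReflection_centre hc]
    refine funext (Fin.cases (hyperplaneReflection_hyperplaneReflection _ _) fun i => rfl)
  have h := det_gram_hyperplaneReflection_comp_left
    (finrank_span_insert_range ha.linearIndependent hyx) hw
    (Submodule.subset_span (mem_insert _ _)) hmem (Fin.cons (y - c) u)
  rw [hR, det_gram_cons fun j => (real_inner_comm _ _).trans (huc j), real_inner_self_eq_norm_sq,
    gram_hyperplaneReflection_comp_left] at h
  rw [h, neg_neg]

theorem isPosSphereFrame_iff_of_mem_span (ha : Orthonormal ℝ a) (hxy : x ≠ y)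
    (hyx : y - x ∈ Submodule.span ℝ (range a)) :
    IsPosSphereFrame x a y u ↔ Orthonormal ℝ u ∧
      (∀ i, hyperplaneReflection (y - x) (u i) ∈ Submodule.span ℝ (range a)) ∧
      (gram a (hyperplaneReflection (y - x) ∘ u)).det < 0 := by
  have hmem : (∀ i, u i ∈ Submodule.span ℝ (range a)) ↔
      ∀ i, hyperplaneReflection (y - x) (u i) ∈ Submodule.span ℝ (range a) :=
    forall_congr' fun i => ⟨hyperplaneReflection_mem hyx, fun h =>
      hyperplaneReflection_hyperplaneReflection (y - x) (u i) ▸ hyperplaneReflection_mem hyx h⟩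
  rw [← gram_hyperplaneReflection_comp_left, det_gram_hyperplaneReflection_comp_left
    ((finrank_span_eq_card ha.linearIndependent).trans (Fintype.card_fin m))
    (sub_ne_zero.2 hxy.symm) hyx (fun i => Submodule.subset_span (mem_range_self i)),
    neg_lt_zero, ← hmem]
  simp only [IsPosSphereFrame, hyx, true_and, not_true_eq_false, false_and, or_false]

theorem isPosSphereFrame_iff_of_notMem_span (ha : Orthonormal ℝ a)
    (hyx : y - x ∉ Submodule.span ℝ (range a)) :
    IsPosSphereFrame x a y u ↔ Orthonormal ℝ u ∧
      (∀ i, hyperplaneReflection (y - x) (u i) ∈ Submodule.span ℝ (range a)) ∧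
      (gram a (hyperplaneReflection (y - x) ∘ u)).det < 0 := by
  have hxy : x ≠ y := fun h => hyx (by rw [h, sub_self]; exact zero_mem _)
  have hwE : y - x ∈ Submodule.span ℝ (insert (y - x) (range a)) :=
    Submodule.subset_span (mem_insert _ _)
  simp only [IsPosSphereFrame, hyx, false_and, false_or, not_false_eq_true, true_and]
  refine and_congr_right fun _ => ⟨?_, ?_⟩
  · rintro ⟨c, hcE, hca, hc, huE, huc, hpos⟩
    refine ⟨fun i => (mem_span_iff_inner_centre_eq_zero hxy hca hc
      (hyperplaneReflection_mem hwE (huE i))).2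
        ((inner_hyperplaneReflection_centre hc _).trans (huc i)), ?_⟩
    rw [det_gram_cons_radial ha hyx hcE hc huc, neg_pos] at hpos
    exact neg_of_mul_neg_right hpos (by positivity)
  · rintro ⟨hu, hneg⟩
    obtain ⟨c, hcE, hca, hc⟩ := exists_centre hyx
    have huE (i) : hyperplaneReflection (y - x) (u i) ∈
        Submodule.span ℝ (insert (y - x) (range a)) :=
      Submodule.span_mono (subset_insert _ _) (hu i)
    have huc (i) : inner ℝ (u i) (y - c) = (0 : ℝ) :=
      (inner_hyperplaneReflection_centre hc _).symm.trans
        ((mem_span_iff_inner_centre_eq_zero hxy hca hc (huE i)).1 (hu i))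
    have hyc : y ≠ c := by
      rintro rfl
      exact hxy (dist_eq_zero.1 (hc.trans (dist_self y)))
    have := norm_pos_iff.2 (sub_ne_zero.2 hyc)
    refine ⟨c, hcE, hca, hc, fun i => ?_, huc, ?_⟩
    · rw [← hyperplaneReflection_hyperplaneReflection (y - x) (u i)]
      exact hyperplaneReflection_mem hwE (huE i)
    · rw [det_gram_cons_radial ha hyx hcE hc huc, neg_pos]
      exact mul_neg_of_pos_of_neg (by positivity) hneg

theorem isPosSphereFrame_iff (ha : Orthonormal ℝ a) (hxy : x ≠ y) :
    IsPosSphereFrame x a y u ↔ Orthonormal ℝ u ∧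
      (∀ i, hyperplaneReflection (y - x) (u i) ∈ Submodule.span ℝ (range a)) ∧
      (gram a (hyperplaneReflection (y - x) ∘ u)).det < 0 := by
  by_cases hyx : y - x ∈ Submodule.span ℝ (range a)
  · exact isPosSphereFrame_iff_of_mem_span ha hxy hyx
  · exact isPosSphereFrame_iff_of_notMem_span ha hyx

theorem IsPosSphereFrame.det_gram (hu : IsPosSphereFrame x a y u) (ha : Orthonormal ℝ a)
    (hxy : x ≠ y) (v : Fin m → Eu n) :
    (gram u v).det = -(gram (hyperplaneReflection (y - x) ∘ a) v).det := by
  obtain ⟨huON, hmem, hneg⟩ := (isPosSphereFrame_iff ha hxy).1 hu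
  have hdet : (gram (hyperplaneReflection (y - x) ∘ u) a).det = -1 := by
    have hsq := det_gram_sq_eq_one (huON.comp_linearIsometryEquiv (hyperplaneReflection (y - x)))
      ha hmem
    rw [det_gram_comm] at hneg
    exact (sq_eq_one_iff.1 hsq).resolve_left (by linarith)
  have hRv : v = hyperplaneReflection (y - x) ∘ hyperplaneReflection (y - x) ∘ v :=
    funext fun i => (hyperplaneReflection_hyperplaneReflection _ _).symm
  rw [hRv, ← gram_hyperplaneReflection_comp_left, ← gram_mul_gram (p := _ ∘ u) ha hmem,
    Matrix.det_mul, hdet, neg_one_mul, ← gram_hyperplaneReflection_comp_left, ← hRv]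

theorem exists_isPosSphereFrame (hm : 1 ≤ m) (ha : Orthonormal ℝ a) (hxy : x ≠ y) :
    ∃ u, IsPosSphereFrame x a y u := by
  set e := a ⟨0, hm⟩
  have he : e ∈ Submodule.span ℝ (range a) := Submodule.subset_span (mem_range_self _)
  refine ⟨hyperplaneReflection (y - x) ∘ hyperplaneReflection e ∘ a,
    (isPosSphereFrame_iff ha hxy).2 ⟨(ha.comp_linearIsometryEquiv _).comp_linearIsometryEquiv _,
      fun i => ?_, ?_⟩⟩
  · rw [Function.comp_apply, hyperplaneReflection_hyperplaneReflection]
    exact hyperplaneReflection_mem he (Submodule.subset_span (mem_range_self i))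
  · have hRR : hyperplaneReflection (y - x) ∘ hyperplaneReflection (y - x) ∘
        hyperplaneReflection e ∘ a = hyperplaneReflection e ∘ a :=
      funext fun i => hyperplaneReflection_hyperplaneReflection _ _
    rw [hRR, det_gram_hyperplaneReflection_comp_self ha (ha.ne_zero _) he]
    exact neg_one_lt_zero

end Sphere

section Kernel

open scoped InnerProduct

variable {m n : ℕ}

/-- The image of the standard frame under a linear map. -/
def stdFrame (A : Eu m →L[ℝ] Eu n) (i : Fin m) : Eu n := A (EuclideanSpace.single i 1)

/-- The determinant of the mixed Gram matrix `(⟨A e i, B e j⟩)` of the images of the standard frame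
`e`. -/
def gramDet (A B : Eu m →L[ℝ] Eu n) : ℝ := (A† ∘L B).det

theorem det_gram_stdFrame (A B : Eu m →L[ℝ] Eu n) :
    (gram (stdFrame A) (stdFrame B)).det = gramDet A B := by
  rw [gramDet, ContinuousLinearMap.det,
    ← LinearMap.det_toMatrix (EuclideanSpace.basisFun (Fin m) ℝ).toBasis]
  congr 1
  ext i j
  rw [LinearMap.toMatrix_apply, OrthonormalBasis.coe_toBasis_repr_apply,
    OrthonormalBasis.repr_apply_apply, OrthonormalBasis.coe_toBasis]
  simp only [EuclideanSpace.basisFun_apply]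
  exact (ContinuousLinearMap.adjoint_inner_right A _ _).symm

theorem gramDet_comm (A B : Eu m →L[ℝ] Eu n) : gramDet A B = gramDet B A := by
  rw [← det_gram_stdFrame, det_gram_comm, det_gram_stdFrame]

theorem gramDet_comp_right (A B : Eu m →L[ℝ] Eu n) (Ψ : Eu m →L[ℝ] Eu m) :
    gramDet A (B ∘L Ψ) = gramDet A B * Ψ.det :=
  LinearMap.det_comp (A† ∘L B).toLinearMap Ψ.toLinearMap

theorem gramDet_comp_left (A B : Eu m →L[ℝ] Eu n) (Φ : Eu m →L[ℝ] Eu m) :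
    gramDet (A ∘L Φ) B = Φ.det * gramDet A B := by
  rw [gramDet_comm, gramDet_comp_right, gramDet_comm, mul_comm]

theorem gramDet_linearIsometry (L : Eu m →ₗᵢ[ℝ] Eu n) :
    gramDet L.toContinuousLinearMap L.toContinuousLinearMap = 1 := by
  rw [gramDet, (ContinuousLinearMap.norm_map_iff_adjoint_comp_self _).1 L.norm_map]
  exact LinearMap.det_id

theorem norm_sub_apply_adjoint_sq (L : Eu m →ₗᵢ[ℝ] Eu n) (y : Eu n) :
    ‖y - L ((L.toContinuousLinearMap†) y)‖ ^ 2 = ‖y‖ ^ 2 - ‖(L.toContinuousLinearMap†) y‖ ^ 2 := by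
  have h : inner ℝ y (L ((L.toContinuousLinearMap†) y)) = ‖(L.toContinuousLinearMap†) y‖ ^ 2 := by
    rw [← real_inner_self_eq_norm_sq, ContinuousLinearMap.adjoint_inner_left]
    rfl
  rw [norm_sub_sq_real, h, L.norm_map]
  ring

theorem norm_adjoint_apply_le (L : Eu m →ₗᵢ[ℝ] Eu n) (y : Eu n) :
    ‖(L.toContinuousLinearMap†) y‖ ≤ ‖y‖ := by
  rw [← pow_le_pow_iff_left₀ (norm_nonneg _) (norm_nonneg _) two_ne_zero, ← sub_nonneg,
    ← norm_sub_apply_adjoint_sq]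
  positivity

theorem norm_adjoint_apply_lt (L : Eu m →ₗᵢ[ℝ] Eu n) {y : Eu n} (hy : y ∉ range L) :
    ‖(L.toContinuousLinearMap†) y‖ < ‖y‖ := by
  have hpos : 0 < ‖y - L ((L.toContinuousLinearMap†) y)‖ :=
    norm_pos_iff.2 (sub_ne_zero.2 fun h => hy ⟨_, h.symm⟩)
  rw [← pow_lt_pow_iff_left₀ (norm_nonneg _) (norm_nonneg _) two_ne_zero, ← sub_pos,
    ← norm_sub_apply_adjoint_sq]
  positivity

theorem abs_det_le_prod_norm (T : Eu m →L[ℝ] Eu m) :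
    |T.det| ≤ ∏ i, ‖T (EuclideanSpace.single i 1)‖ := by
  have : Fact (Module.finrank ℝ (Eu m) = m) := ⟨finrank_euclideanSpace_fin⟩
  let e := EuclideanSpace.basisFun (Fin m) ℝ
  have h := e.toBasis.orientation.abs_volumeForm_apply_le (T.toLinearMap ∘ e.toBasis)
  rw [e.toBasis.orientation.volumeForm_robust' e, Module.Basis.det_comp_basis] at h
  simpa [e] using h

theorem abs_gramDet_lt_one {LA LB : Eu m →ₗᵢ[ℝ] Eu n}
    (h : LinearMap.range LA.toLinearMap ≠ LinearMap.range LB.toLinearMap) :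
    |gramDet LA.toContinuousLinearMap LB.toContinuousLinearMap| < 1 := by
  have hLB (i) : ‖LB (EuclideanSpace.single i 1)‖ = 1 := by
    rw [LB.norm_map, PiLp.norm_single, norm_one]
  obtain ⟨i, hi⟩ : ∃ i, LB (EuclideanSpace.single i 1) ∉ range LA := by
    by_contra! hcon
    refine h (Submodule.eq_of_le_of_finrank_eq ?_ ?_).symm
    · rw [LinearMap.range_eq_map, ← (EuclideanSpace.basisFun (Fin m) ℝ).toBasis.span_eq,
        Submodule.map_span_le]
      rintro _ ⟨i, rfl⟩
      simpa using hcon i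
    · rw [LinearMap.finrank_range_of_inj LA.injective, LinearMap.finrank_range_of_inj LB.injective]
  refine (abs_det_le_prod_norm _).trans_lt ?_
  rw [← Finset.mul_prod_erase _ _ (Finset.mem_univ i)]
  exact mul_lt_one_of_nonneg_of_lt_one_left (norm_nonneg _)
    ((norm_adjoint_apply_lt LA hi).trans_eq (hLB i))
    (Finset.prod_le_one (fun _ _ => norm_nonneg _) fun j _ =>
      (norm_adjoint_apply_le LA _).trans_eq (hLB j))

/-- The reflection `hyperplaneReflection w` as a continuous linear map. -/
def reflectionCLM (w : Eu n) : Eu n →L[ℝ] Eu n :=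
  (hyperplaneReflection w).toContinuousLinearEquiv.toContinuousLinearMap

theorem continuousAt_reflectionCLM {w : Eu n} (hw : w ≠ 0) : ContinuousAt reflectionCLM w := by
  refine continuousAt_clm_apply.2 fun z => ?_
  have h (w : Eu n) : reflectionCLM w z = z - (2 * inner ℝ w z / ‖w‖ ^ 2) • w :=
    hyperplaneReflection_apply w z
  simp only [h]
  have : ‖w‖ ^ 2 ≠ 0 := pow_ne_zero 2 (norm_ne_zero_iff.2 hw)
  fun_prop (disch := assumption)

/-- The cosine of the combined angle between `x` and `y = x + w`, for two sheets with tangent maps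
`A` at `x` and `B` at `y` that are oriented by their parametrizations. -/
def angleCos (A B : Eu m →L[ℝ] Eu n) (w : Eu n) : ℝ :=
  -gramDet A (reflectionCLM w ∘L B) / √(gramDet A A * gramDet B B)

theorem angleCos_smul (A B : Eu m →L[ℝ] Eu n) {t : ℝ} (ht : t ≠ 0) (w : Eu n) :
    angleCos A B (t • w) = angleCos A B w := by
  rw [angleCos, reflectionCLM, hyperplaneReflection_smul ht]
  rfl

theorem neg_det_gram_eq_angleCos {A B : Eu m →L[ℝ] Eu n} {Φ Ψ : Eu m →L[ℝ] Eu m} {s t : ℝ}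
    (hA : Orthonormal ℝ (stdFrame (A ∘L Φ))) (hB : Orthonormal ℝ (stdFrame (B ∘L Ψ)))
    (hs : |s| = 1) (ht : |t| = 1) (hΦ : 0 < s * Φ.det) (hΨ : 0 < t * Ψ.det) (w : Eu n) :
    -(gram (hyperplaneReflection w ∘ stdFrame (A ∘L Φ)) (stdFrame (B ∘L Ψ))).det =
      s * t * angleCos A B w := by
  have hnorm {A : Eu m →L[ℝ] Eu n} {Φ} (hA : Orthonormal ℝ (stdFrame (A ∘L Φ))) :
      Φ.det ^ 2 * gramDet A A = 1 := by
    have h := det_gram_stdFrame (A ∘L Φ) (A ∘L Φ)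
    rw [gram_self_eq_one hA, Matrix.det_one, gramDet_comp_left, gramDet_comp_right] at h
    rw [h]
    ring
  have hdet : (gram (hyperplaneReflection w ∘ stdFrame (A ∘L Φ)) (stdFrame (B ∘L Ψ))).det =
      Φ.det * gramDet A (reflectionCLM w ∘L B) * Ψ.det := by
    rw [← gramDet_comp_left, ← gramDet_comp_right, ← det_gram_stdFrame,
      gram_hyperplaneReflection_comp_left]
    rfl
  have hss : s * s = 1 := by rw [← abs_mul_abs_self, hs, one_mul]
  have htt : t * t = 1 := by rw [← abs_mul_abs_self, ht, one_mul]
  have hpos : 0 < (s * Φ.det) * (t * Ψ.det) := mul_pos hΦ hΨ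
  have hsqrt : √(gramDet A A * gramDet B B) = ((s * Φ.det) * (t * Ψ.det))⁻¹ := by
    rw [Real.sqrt_eq_iff_mul_self_eq_of_pos (inv_pos.2 hpos), ← mul_inv, inv_eq_iff_eq_inv]
    refine eq_inv_of_mul_eq_one_left ?_
    linear_combination (s * s * t * t * Φ.det ^ 2 * gramDet A A) * hnorm hB
      + s * s * t * t * hnorm hA + t * t * hss + htt
  rw [hdet, angleCos, hsqrt, div_inv_eq_mul]
  linear_combination (Φ.det * gramDet A (reflectionCLM w ∘L B) * Ψ.det) * (t * t * hss + htt)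

theorem angleCos_linearIsometry (LA LB : Eu m →ₗᵢ[ℝ] Eu n) (w : Eu n) :
    angleCos LA.toContinuousLinearMap LB.toContinuousLinearMap w =
      -gramDet LA.toContinuousLinearMap (reflectionCLM w ∘L LB.toContinuousLinearMap) := by
  rw [angleCos, gramDet_linearIsometry, gramDet_linearIsometry, one_mul, Real.sqrt_one, div_one]

theorem angleCos_of_orthogonal (L : Eu m →ₗᵢ[ℝ] Eu n) {w : Eu n}
    (hw : ∀ z, inner ℝ (L z) w = (0 : ℝ)) :
    angleCos L.toContinuousLinearMap L.toContinuousLinearMap w = -1 := by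
  have h : reflectionCLM w ∘L L.toContinuousLinearMap = L.toContinuousLinearMap := by
    ext1 z
    refine (hyperplaneReflection_apply w (L z)).trans ?_
    rw [real_inner_comm, hw, mul_zero, zero_div, zero_smul, sub_zero]
    rfl
  rw [angleCos_linearIsometry, h, gramDet_linearIsometry]

theorem reflectionCLM_comp_linearIsometry (L : Eu m →ₗᵢ[ℝ] Eu n) (e : Eu m) :
    reflectionCLM (L e) ∘L L.toContinuousLinearMap =
      L.toContinuousLinearMap ∘L reflectionCLM e := by
  ext1 z
  refine (hyperplaneReflection_apply (L e) (L z)).trans ?_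
  rw [L.inner_map_map, L.norm_map, ← map_smul, ← map_sub, ← hyperplaneReflection_apply]
  rfl

theorem gramDet_reflectionCLM_comp (LA LB : Eu m →ₗᵢ[ℝ] Eu n) {e : Eu m} (he : e ≠ 0) :
    gramDet LA.toContinuousLinearMap (reflectionCLM (LA e) ∘L LB.toContinuousLinearMap) =
      -gramDet LA.toContinuousLinearMap LB.toContinuousLinearMap := by
  have h : gramDet LA.toContinuousLinearMap (reflectionCLM (LA e) ∘L LB.toContinuousLinearMap) =
      gramDet (reflectionCLM (LA e) ∘L LA.toContinuousLinearMap) LB.toContinuousLinearMap := by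
    rw [← det_gram_stdFrame, ← det_gram_stdFrame]
    exact congrArg Matrix.det (gram_hyperplaneReflection_comp_left _ _ _).symm
  rw [h, reflectionCLM_comp_linearIsometry, gramDet_comp_left]
  exact (congrArg (· * _) (det_hyperplaneReflection he)).trans (neg_one_mul _)

theorem angleCos_tangent (LA LB : Eu m →ₗᵢ[ℝ] Eu n) {e : Eu m} (he : e ≠ 0) :
    angleCos LA.toContinuousLinearMap LB.toContinuousLinearMap (LA e) =
      gramDet LA.toContinuousLinearMap LB.toContinuousLinearMap := by
  rw [angleCos_linearIsometry, gramDet_reflectionCLM_comp _ _ he, neg_neg]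

theorem continuousAt_gramDet {X : Type*} [TopologicalSpace X] {A B : X → Eu m →L[ℝ] Eu n} {x : X}
    (hA : ContinuousAt A x) (hB : ContinuousAt B x) :
    ContinuousAt (fun x => gramDet (A x) (B x)) x :=
  ContinuousLinearMap.continuous_det.continuousAt.comp
    ((ContinuousLinearMap.adjoint.continuous.continuousAt.comp hA).clm_comp hB)

theorem continuousAt_angleCos {X : Type*} [TopologicalSpace X] {A B : X → Eu m →L[ℝ] Eu n}
    {w : X → Eu n} {x : X} (hA : ContinuousAt A x) (hB : ContinuousAt B x) (hw : ContinuousAt w x)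
    (hw₀ : w x ≠ 0) (hAB : 0 < gramDet (A x) (A x) * gramDet (B x) (B x)) :
    ContinuousAt (fun x => angleCos (A x) (B x) (w x)) x :=
  (continuousAt_gramDet hA
    (((continuousAt_reflectionCLM hw₀).comp hw).clm_comp hB)).neg.div
    ((continuousAt_gramDet hA hA).mul (continuousAt_gramDet hB hB)).sqrt (Real.sqrt_pos.2 hAB).ne'

theorem exists_angleCos_mem {LA LB : Eu m →ₗᵢ[ℝ] Eu n} {S : Set (Eu n)} (hS : IsCompact S)
    (hS₀ : (0 : Eu n) ∉ S) {U : Set ℝ} (hU : IsOpen U)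
    (h : ∀ w ∈ S, angleCos LA.toContinuousLinearMap LB.toContinuousLinearMap w ∈ U) :
    ∃ δ > 0, ∀ (A B : Eu m →L[ℝ] Eu n) (w w₀ : Eu n) (t : ℝ), ‖A - LA.toContinuousLinearMap‖ < δ →
      ‖B - LB.toContinuousLinearMap‖ < δ → w₀ ∈ S → 0 < t → ‖w - t • w₀‖ < δ * t →
      angleCos A B w ∈ U := by
  have hT : IsCompact ({LA.toContinuousLinearMap} ×ˢ {LB.toContinuousLinearMap} ×ˢ S) :=
    isCompact_singleton.prod (isCompact_singleton.prod hS)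
  have hmem : {p : (Eu m →L[ℝ] Eu n) × (Eu m →L[ℝ] Eu n) × Eu n | angleCos p.1 p.2.1 p.2.2 ∈ U} ∈
      𝓝ˢ ({LA.toContinuousLinearMap} ×ˢ {LB.toContinuousLinearMap} ×ˢ S) := by
    refine mem_nhdsSet_iff_forall.2 ?_
    rintro ⟨_, _, w⟩ ⟨rfl, rfl, hw⟩
    refine (continuousAt_angleCos continuousAt_fst (continuousAt_fst.comp continuousAt_snd)
      (continuousAt_snd.comp continuousAt_snd) (ne_of_mem_of_not_mem hw hS₀) ?_).preimage_mem_nhds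
        (hU.mem_nhds (h w hw))
    simp only [Function.comp_apply, gramDet_linearIsometry, mul_one, one_pos]
  obtain ⟨δ, hδ, hsub⟩ := (Metric.hasBasis_nhdsSet_thickening hT).mem_iff.1 hmem
  refine ⟨δ, hδ, fun A B w w₀ t hA hB hw₀ ht hw => ?_⟩
  rw [← angleCos_smul A B (inv_ne_zero ht.ne') w]
  refine hsub (a := (A, B, t⁻¹ • w)) (Metric.mem_thickening_iff.2 ⟨(_, _, w₀), ⟨rfl, rfl, hw₀⟩, ?_⟩)
  have hdist : dist (t⁻¹ • w) w₀ < δ := by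
    have : w - t • w₀ = t • (t⁻¹ • w - w₀) := by rw [smul_sub, smul_inv_smul₀ ht.ne']
    rwa [this, norm_smul, Real.norm_of_nonneg ht.le, mul_comm, mul_lt_mul_iff_left₀ ht,
      ← dist_eq_norm] at hw
  exact max_lt ((dist_eq_norm _ _).trans_lt hA) (max_lt ((dist_eq_norm _ _).trans_lt hB) hdist)

theorem isCompact_unit_inter_orthogonal (L : Eu m →ₗᵢ[ℝ] Eu n) :
    IsCompact {w : Eu n | ‖w‖ = 1 ∧ ∀ z, inner ℝ (L z) w = (0 : ℝ)} := by
  refine (isCompact_sphere (0 : Eu n) 1).of_isClosed_subset ?_ fun w hw =>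
    mem_sphere_zero_iff_norm.2 hw.1
  have hclosed (z : Eu m) : IsClosed {w : Eu n | inner ℝ (L z) w = (0 : ℝ)} :=
    isClosed_eq (continuous_const.inner continuous_id) continuous_const
  rw [Set.ofPred_and, Set.ofPred_forall]
  exact (isClosed_eq continuous_norm continuous_const).inter (isClosed_iInter hclosed)

theorem exists_angleCos_neg_of_normal (L : Eu m →ₗᵢ[ℝ] Eu n) :
    ∃ δ > 0, ∀ (A B : Eu m →L[ℝ] Eu n) (w ν : Eu n), ‖A - L.toContinuousLinearMap‖ < δ →
      ‖B - L.toContinuousLinearMap‖ < δ → ν ≠ 0 → (∀ z, inner ℝ (L z) ν = (0 : ℝ)) →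
      ‖w - ν‖ < δ * ‖ν‖ → angleCos A B w < 0 := by
  obtain ⟨δ, hδ, h⟩ := exists_angleCos_mem (isCompact_unit_inter_orthogonal L)
    (fun h => zero_ne_one (α := ℝ) (norm_zero.symm.trans h.1)) isOpen_Iio fun w hw =>
      (angleCos_of_orthogonal L hw.2).trans_lt neg_one_lt_zero
  refine ⟨δ, hδ, fun A B w ν hA hB hν hL hw => h A B w (‖ν‖⁻¹ • ν) ‖ν‖ hA hB
    ⟨norm_smul_inv_norm hν, fun z => ?_⟩ (norm_pos_iff.2 hν) ?_⟩
  · rw [real_inner_smul_right, hL, mul_zero]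
  · rwa [smul_inv_smul₀ (norm_ne_zero_iff.2 hν)]

theorem exists_angleCos_pos_of_tangent (L : Eu m →ₗᵢ[ℝ] Eu n) {e : Eu m} (he : e ≠ 0) :
    ∃ δ > 0, ∀ (A B : Eu m →L[ℝ] Eu n) (w : Eu n) (t : ℝ), ‖A - L.toContinuousLinearMap‖ < δ →
      ‖B - L.toContinuousLinearMap‖ < δ → 0 < t → ‖w - t • L e‖ < δ * t → 0 < angleCos A B w := by
  obtain ⟨δ, hδ, h⟩ := exists_angleCos_mem (isCompact_singleton (x := L e))
    (fun h => he ((map_eq_zero_iff L L.injective).1 (mem_singleton_iff.1 h).symm)) isOpen_Ioi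
    fun w hw => by
      rw [mem_singleton_iff.1 hw, angleCos_tangent L L he, gramDet_linearIsometry]
      exact zero_lt_one' ℝ
  exact ⟨δ, hδ, fun A B w t hA hB ht hw => h A B w (L e) t hA hB rfl ht hw⟩

theorem exists_abs_angleCos_lt_of_transversal {LA LB : Eu m →ₗᵢ[ℝ] Eu n}
    (hne : LinearMap.range LA.toLinearMap ≠ LinearMap.range LB.toLinearMap)
    {e : Eu m} (he : e ≠ 0) :
    ∃ κ > 0, ∃ δ > 0, ∀ (A B : Eu m →L[ℝ] Eu n) (w : Eu n) (t : ℝ),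
      ‖A - LA.toContinuousLinearMap‖ < δ → ‖B - LB.toContinuousLinearMap‖ < δ → 0 < t →
      ‖w - t • LA e‖ < δ * t → |angleCos A B w| < 1 - κ := by
  obtain ⟨c, hc, hc₁⟩ := exists_between (abs_gramDet_lt_one hne)
  obtain ⟨δ, hδ, h⟩ := exists_angleCos_mem (isCompact_singleton (x := LA e))
    (fun h => he ((map_eq_zero_iff LA LA.injective).1 (mem_singleton_iff.1 h).symm))
    (isOpen_Iio.preimage continuous_abs) fun w hw => by
      rw [mem_singleton_iff.1 hw, angleCos_tangent LA LB he]
      exact hc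
  refine ⟨1 - c, sub_pos.2 hc₁, δ, hδ, fun A B w t hA hB ht hw => ?_⟩
  rw [sub_sub_cancel]
  exact h A B w (LA e) t hA hB rfl ht hw

end Kernel

section Sheets

variable {m n : ℕ}

/-- On the ball of radius `r` about the origin `G` is `C¹`-close, at scale `r`, to the isometric
parametrization `z ↦ q + L z` of an `m`-plane. -/
structure NearlyFlat (L : Eu m →ₗᵢ[ℝ] Eu n) (q : Eu n) (r ε : ℝ) (G : Eu m → Eu n) : Prop where
  radius_pos : 0 < r
  differentiableAt : ∀ z ∈ Metric.ball 0 r, DifferentiableAt ℝ G z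
  norm_fderiv_sub_le : ∀ z ∈ Metric.ball 0 r, ‖fderiv ℝ G z - L.toContinuousLinearMap‖ ≤ ε
  norm_base_le : ‖G 0 - q‖ ≤ ε * r

namespace NearlyFlat

variable {L : Eu m →ₗᵢ[ℝ] Eu n} {q : Eu n} {r ε : ℝ} {G : Eu m → Eu n} {z z' : Eu m}

theorem norm_image_sub_le (h : NearlyFlat L q r ε G) (hz : z ∈ Metric.ball 0 r)
    (hz' : z' ∈ Metric.ball 0 r) : ‖G z' - G z - L (z' - z)‖ ≤ ε * ‖z' - z‖ :=
  (convex_ball (0 : Eu m) r).norm_image_sub_le_of_norm_fderiv_le'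
    (φ := L.toContinuousLinearMap) h.differentiableAt h.norm_fderiv_sub_le hz hz'

theorem antilipschitzWith (h : NearlyFlat L q r ε G) (hε : ε ≤ 1 / 2) :
    AntilipschitzWith 2 ((Metric.ball 0 r).domRestrict G) := by
  refine .of_le_mul_dist fun z z' => ?_
  rw [Subtype.dist_eq, dist_eq_norm, dist_eq_norm, domRestrict_apply, domRestrict_apply]
  have hflat := h.norm_image_sub_le z'.2 z.2
  have htri := norm_sub_norm_le (L (z - z')) (G z - G z')
  rw [L.norm_map, norm_sub_rev (L _)] at htri
  push_cast
  nlinarith [norm_nonneg ((z : Eu m) - z')]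

theorem norm_offset_le (h : NearlyFlat L q r ε G) (hε : 0 ≤ ε) (hz : z ∈ Metric.ball 0 r) :
    ‖G z - q - L z‖ ≤ 2 * ε * r := by
  have hflat := h.norm_image_sub_le (Metric.mem_ball_self h.radius_pos) hz
  have hz_lt := mem_ball_zero_iff.1 hz
  rw [sub_zero] at hflat
  calc ‖G z - q - L z‖ = ‖(G z - G 0 - L z) + (G 0 - q)‖ := by congr 1; abel
    _ ≤ ε * ‖z‖ + ε * r := norm_add_le_of_le hflat h.norm_base_le
    _ ≤ 2 * ε * r := by nlinarith

end NearlyFlat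

theorem volume_image_val_le_of_antilipschitz {K : Set (Eu m)} {G : Eu m → Eu n} {c : ℝ≥0}
    (hG : AntilipschitzWith c (K.domRestrict G)) (t : Set K) :
    volume (Subtype.val '' t) ≤ (c : ℝ≥0∞) ^ m * μHE[m] (K.domRestrict G '' t) := by
  have h := hG.le_hausdorffMeasure_image (Nat.cast_nonneg m) t
  rw [← isometry_subtype_coe.hausdorffMeasure_image (.inl (Nat.cast_nonneg m)),
    ENNReal.rpow_natCast] at h
  rw [← EuclideanSpace.euclideanHausdorffMeasure_eq_volume]
  simp only [Measure.euclideanHausdorffMeasure_def, Measure.smul_apply, ENNReal.smul_def,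
    smul_eq_mul]
  rw [mul_left_comm]
  gcongr

theorem lintegral_comp_le_of_antilipschitz {K : Set (Eu m)} (hK : MeasurableSet K)
    {G : Eu m → Eu n} (hcont : ContinuousOn G K) {c : ℝ≥0}
    (hG : AntilipschitzWith c (K.domRestrict G)) (F : Eu n → ℝ≥0∞) :
    ∫⁻ z in K, F (G z) ≤ (c : ℝ≥0∞) ^ m * ∫⁻ y in G '' K, F y ∂μHE[m] := by
  have := hK.standardBorel
  have hemb : MeasurableEmbedding (K.domRestrict G) :=
    hcont.domRestrict.measurable.measurableEmbedding hG.injective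
  have hmap : (Measure.comap Subtype.val (volume : Measure (Eu m))).map (K.domRestrict G) ≤
      (c : ℝ≥0∞) ^ m • (μHE[m] : Measure (Eu n)).restrict (G '' K) := by
    refine Measure.le_iff.2 fun T hT => ?_
    have himage : K.domRestrict G '' (K.domRestrict G ⁻¹' T) = T ∩ G '' K := by
      rw [image_preimage_eq_inter_range, range_domRestrict]
    rw [hemb.map_apply, comap_subtype_coe_apply hK, Measure.smul_apply, smul_eq_mul,
      Measure.restrict_apply hT, ← himage]
    exact volume_image_val_le_of_antilipschitz hG _
  calc ∫⁻ z in K, F (G z)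
      = ∫⁻ y, F y ∂(Measure.comap Subtype.val volume).map (K.domRestrict G) := by
        rw [← lintegral_subtype_comap hK, hemb.lintegral_map]
        rfl
    _ ≤ ∫⁻ y, F y ∂((c : ℝ≥0∞) ^ m • (μHE[m] : Measure (Eu n)).restrict (G '' K)) :=
        lintegral_mono' hmap le_rfl
    _ = (c : ℝ≥0∞) ^ m * ∫⁻ y in G '' K, F y ∂μHE[m] := lintegral_smul_measure _ _

theorem NearlyFlat.lintegral_comp_le {L : Eu m →ₗᵢ[ℝ] Eu n} {q : Eu n} {r ε : ℝ}
    {G : Eu m → Eu n} (h : NearlyFlat L q r ε G) (hε : ε ≤ 1 / 2) {S : Set (Eu n)}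
    (hS : MapsTo G (Metric.ball 0 r) S) (F : Eu n → ℝ≥0∞) :
    ∫⁻ z in Metric.ball 0 r, F (G z) ≤ 2 ^ m * ∫⁻ y in S, F y ∂μHE[m] :=
  (lintegral_comp_le_of_antilipschitz measurableSet_ball
    (fun z hz => (h.differentiableAt z hz).continuousAt.continuousWithinAt)
    (h.antilipschitzWith hε) F).trans (by gcongr; exacts [le_rfl, hS.image_subset])

/-- The integrand of the Kusner–Sullivan energy, for an arbitrary function `c` in place of the
cosine of the combined angle. -/
def energyDensity (m : ℕ) (c : Eu n → Eu n → ℝ) (x y : Eu n) : ℝ≥0∞ :=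
  ENNReal.ofReal ((1 - c x y) ^ m / dist x y ^ (2 * m))

/-- The double integral of the Kusner–Sullivan energy over `S × S`, for an arbitrary function `c`
in place of the cosine of the combined angle. -/
def pairEnergy (m : ℕ) (S : Set (Eu n)) (c : Eu n → Eu n → ℝ) : ℝ≥0∞ :=
  ∫⁻ x in S, ∫⁻ y in S, energyDensity m c x y ∂μHE[m] ∂μHE[m]

theorem ofReal_le_energyDensity {c : Eu n → Eu n → ℝ} {x y : Eu n} {κ d : ℝ} (hκ : 0 ≤ κ)
    (hc : κ ≤ 1 - c x y) (hxy : x ≠ y) (hd : dist x y ≤ d) :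
    ENNReal.ofReal (κ ^ m / d ^ (2 * m)) ≤ energyDensity m c x y := by
  have hdist := dist_pos.2 hxy
  have hc₀ := hκ.trans hc
  unfold energyDensity
  gcongr

theorem ofReal_mul_volume_ball_le_setLIntegral {z : Eu m} {ρ k : ℝ} (hρ : 0 < ρ) (hk : 0 ≤ k)
    {F : Eu m → ℝ≥0∞} (hF : ∀ z' ∈ Metric.ball z ρ, ENNReal.ofReal k ≤ F z') :
    ENNReal.ofReal (k * (ρ ^ m * volume.real (Metric.ball (0 : Eu m) 1))) ≤
      ∫⁻ z' in Metric.ball z ρ, F z' := by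
  calc ENNReal.ofReal (k * (ρ ^ m * volume.real (Metric.ball (0 : Eu m) 1)))
      = ENNReal.ofReal k * volume (Metric.ball z ρ) := by
        rw [ENNReal.ofReal_mul hk, Measure.addHaar_ball_of_pos _ _ hρ, finrank_euclideanSpace_fin,
          ENNReal.ofReal_mul (by positivity), ofReal_measureReal measure_ball_lt_top.ne]
    _ = ∫⁻ _ in Metric.ball z ρ, ENNReal.ofReal k := (setLIntegral_const _ _).symm
    _ ≤ ∫⁻ z' in Metric.ball z ρ, F z' := setLIntegral_mono' measurableSet_ball hF

theorem volume_real_unit_ball_pos : 0 < volume.real (Metric.ball (0 : Eu m) 1) :=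
  ENNReal.toReal_pos (Metric.measure_ball_pos _ _ one_pos).ne' measure_ball_lt_top.ne

/-- Two disjoint nearly flat sheets in `S`, over the planes `q + LA` and `q + LB`, such that `c` is
given across them by the cosine of the combined angle. The sign `s` is `1` if the orientations for
which `c` is the cosine are induced by the parametrizations, up to reversing both of them, and `-1`
if just one of them is. -/
structure SheetPair (LA LB : Eu m →ₗᵢ[ℝ] Eu n) (q : Eu n) (r ε : ℝ) (S : Set (Eu n))
    (c : Eu n → Eu n → ℝ) (s : ℝ) (GA GB : Eu m → Eu n) : Prop where
  flatA : NearlyFlat LA q r ε GA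
  flatB : NearlyFlat LB q r ε GB
  mapsA : MapsTo GA (Metric.ball 0 r) S
  mapsB : MapsTo GB (Metric.ball 0 r) S
  ne : ∀ z ∈ Metric.ball 0 r, ∀ z' ∈ Metric.ball 0 r, GA z ≠ GB z'
  abs_sign : |s| = 1
  angle : ∀ z ∈ Metric.ball 0 r, ∀ z' ∈ Metric.ball 0 r,
    c (GA z) (GB z') = s * angleCos (fderiv ℝ GA z) (fderiv ℝ GB z') (GB z' - GA z)

namespace SheetPair

variable {LA LB : Eu m →ₗᵢ[ℝ] Eu n} {q : Eu n} {r ε : ℝ} {S : Set (Eu n)} {c : Eu n → Eu n → ℝ}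
  {s : ℝ} {GA GB : Eu m → Eu n}

theorem lintegral_le (h : SheetPair LA LB q r ε S c s GA GB) (hε : ε ≤ 1 / 2) :
    ∫⁻ z in Metric.ball 0 r, ∫⁻ z' in Metric.ball 0 r, energyDensity m c (GA z) (GB z') ≤
      4 ^ m * pairEnergy m S c := by
  have htop : (2 : ℝ≥0∞) ^ m ≠ ⊤ := by finiteness
  calc ∫⁻ z in Metric.ball 0 r, ∫⁻ z' in Metric.ball 0 r, energyDensity m c (GA z) (GB z')
      ≤ ∫⁻ z in Metric.ball 0 r, 2 ^ m * ∫⁻ y in S, energyDensity m c (GA z) y ∂μHE[m] :=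
        lintegral_mono fun z => h.flatB.lintegral_comp_le hε h.mapsB _
    _ ≤ 2 ^ m * ∫⁻ x in S, 2 ^ m * ∫⁻ y in S, energyDensity m c x y ∂μHE[m] ∂μHE[m] :=
        h.flatA.lintegral_comp_le hε h.mapsA
          fun x => 2 ^ m * ∫⁻ y in S, energyDensity m c x y ∂μHE[m]
    _ = 4 ^ m * pairEnergy m S c := by
        rw [lintegral_const_mul' _ _ htop, ← mul_assoc, ← mul_pow, pairEnergy]
        norm_num

theorem lt_pairEnergy (h : SheetPair LA LB q r ε S c s GA GB) (hε : ε ≤ 1 / 2) {C : ℝ≥0∞}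
    (hC : 4 ^ m * C <
      ∫⁻ z in Metric.ball 0 r, ∫⁻ z' in Metric.ball 0 r, energyDensity m c (GA z) (GB z')) :
    C < pairEnergy m S c :=
  lt_of_mul_lt_mul_left' (hC.trans_le (h.lintegral_le hε))

theorem norm_chord_sub_le (h : SheetPair LA LB q r ε S c s GA GB) (hε : 0 ≤ ε) {z z' : Eu m}
    (hz : z ∈ Metric.ball 0 r) (hz' : z' ∈ Metric.ball 0 r) (a : Eu m) :
    ‖GB z' - GA z - LA a‖ ≤ 4 * ε * r + ‖z + a‖ + ‖z'‖ := by
  have hA := h.flatA.norm_offset_le hε hz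
  have hB := h.flatB.norm_offset_le hε hz'
  calc ‖GB z' - GA z - LA a‖
      = ‖(GB z' - q - LB z') - (GA z - q - LA z) - LA (z + a) + LB z'‖ := by
        rw [map_add]; congr 1; abel
    _ ≤ 2 * ε * r + 2 * ε * r + ‖LA (z + a)‖ + ‖LB z'‖ :=
        norm_add_le_of_le (norm_sub_le_of_le (norm_sub_le_of_le hB hA) le_rfl) le_rfl
    _ = 4 * ε * r + ‖z + a‖ + ‖z'‖ := by rw [LA.norm_map, LB.norm_map]; ring

end SheetPair

theorem eventually_nhdsGT_zero_lt {f : ℝ → ℝ} (hf : Continuous f) {b : ℝ} (hb : f 0 < b) :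
    ∀ᶠ ε in 𝓝[>] 0, f ε < b :=
  (hf.continuousAt.eventually_lt_const hb).filter_mono nhdsWithin_le_nhds

end Sheets

section Transversal

variable {m n : ℕ} {LA LB : Eu m →ₗᵢ[ℝ] Eu n}

theorem ball_neg_smul_subset {e : Eu m} (he : ‖e‖ = 1) {r R τ : ℝ} (hτ : τ ≤ 1 / 4) (hR : 0 ≤ R)
    (hRr : R ≤ r / 2) : Metric.ball (-R • e) (τ * R) ⊆ Metric.ball 0 r := by
  refine Metric.ball_subset_ball' ?_
  rw [dist_zero_right, norm_smul, he, mul_one, norm_neg, Real.norm_of_nonneg hR]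
  nlinarith

theorem exists_ofReal_le_energyDensity_of_transversal
    (hne : LinearMap.range LA.toLinearMap ≠ LinearMap.range LB.toLinearMap)
    {e : Eu m} (he : ‖e‖ = 1) :
    ∃ κ > 0, ∃ τ ∈ Ioc (0 : ℝ) (1 / 4), ∀ᶠ ε in 𝓝[>] (0 : ℝ),
      ∀ q r S c s GA GB, SheetPair LA LB q r ε S c s GA GB →
        ∀ R, 0 < R → R ≤ r / 2 → 4 * ε * r ≤ τ * R →
          ∀ z ∈ Metric.ball (-R • e) (τ * R), ∀ z' ∈ Metric.ball (0 : Eu m) (τ * R),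
            ENNReal.ofReal (κ ^ m / (2 * R) ^ (2 * m)) ≤ energyDensity m c (GA z) (GB z') := by
  obtain ⟨κ, hκ, δ, hδ, hangle⟩ :=
    exists_abs_angleCos_lt_of_transversal hne (norm_ne_zero_iff.1 (by rw [he]; exact one_ne_zero))
  have hτδ : 3 * min (δ / 3) (1 / 4) ≤ δ := by linarith [min_le_left (δ / 3) (1 / 4)]
  have hτ₄ : min (δ / 3) (1 / 4) ≤ 1 / 4 := min_le_right _ _
  refine ⟨κ, hκ, min (δ / 3) (1 / 4), ⟨by positivity, hτ₄⟩, ?_⟩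
  generalize min (δ / 3) (1 / 4) = τ at hτδ hτ₄
  filter_upwards [Ioo_mem_nhdsGT hδ] with ε hε q r S c s GA GB h R hR hRr hεR z hz z' hz'
  have hzr := ball_neg_smul_subset he hτ₄ hR.le hRr hz
  have hzr' : z' ∈ Metric.ball 0 r := Metric.ball_subset_ball (by nlinarith) hz'
  rw [mem_ball_iff_norm, neg_smul, sub_neg_eq_add] at hz
  rw [mem_ball_zero_iff] at hz'
  have hchord : ‖GB z' - GA z - R • LA e‖ < 3 * τ * R := by
    have := h.norm_chord_sub_le hε.1.le hzr hzr' (R • e)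
    rw [map_smul] at this
    linarith
  have hcos := hangle (fderiv ℝ GA z) (fderiv ℝ GB z') (GB z' - GA z) R
    ((h.flatA.norm_fderiv_sub_le z hzr).trans_lt hε.2)
    ((h.flatB.norm_fderiv_sub_le z' hzr').trans_lt hε.2) hR (hchord.trans_le (by gcongr))
  refine ofReal_le_energyDensity hκ.le ?_ (h.ne z hzr z' hzr') ?_
  · have := le_abs_self (c (GA z) (GB z'))
    rw [h.angle z hzr z' hzr', abs_mul, h.abs_sign, one_mul] at this
    rw [h.angle z hzr z' hzr']
    linarith
  · have := norm_sub_norm_le (GB z' - GA z) (R • LA e)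
    rw [norm_smul, LA.norm_map, he, mul_one, Real.norm_of_nonneg hR.le] at this
    rw [dist_comm, dist_eq_norm]
    nlinarith

theorem exists_le_lintegral_of_transversal
    (hne : LinearMap.range LA.toLinearMap ≠ LinearMap.range LB.toLinearMap)
    {e : Eu m} (he : ‖e‖ = 1) :
    ∃ τ ∈ Ioc (0 : ℝ) (1 / 4), ∃ b : ℝ≥0∞, b ≠ 0 ∧ ∀ᶠ ε in 𝓝[>] (0 : ℝ),
      ∀ q r S c s GA GB, SheetPair LA LB q r ε S c s GA GB →
        ∀ R, 0 < R → R ≤ r / 2 → 4 * ε * r ≤ τ * R →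
          b ≤ ∫⁻ z in Metric.ball (-R • e) (τ * R), ∫⁻ z' in Metric.ball 0 r,
            energyDensity m c (GA z) (GB z') := by
  obtain ⟨κ, hκ, τ, ⟨hτ, hτ₄⟩, hpoint⟩ := exists_ofReal_le_energyDensity_of_transversal hne he
  have hΩ := volume_real_unit_ball_pos (m := m)
  refine ⟨τ, ⟨hτ, hτ₄⟩,
    .ofReal (κ ^ m * (τ / 2) ^ (2 * m) * volume.real (Metric.ball (0 : Eu m) 1) ^ 2),
    (ENNReal.ofReal_pos.2 (by positivity)).ne', ?_⟩
  filter_upwards [hpoint] with ε hpoint q r S c s GA GB h R hR hRr hεR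
  have hsub : Metric.ball (0 : Eu m) (τ * R) ⊆ Metric.ball 0 r :=
    Metric.ball_subset_ball (by nlinarith)
  convert ofReal_mul_volume_ball_le_setLIntegral (mul_pos hτ hR) (by positivity) fun z hz =>
    (ofReal_mul_volume_ball_le_setLIntegral (mul_pos hτ hR) (by positivity)
      (hpoint q r S c s GA GB h R hR hRr hεR z hz)).trans (lintegral_mono_set hsub) using 2
  field_simp
  rw [← mul_pow, ← pow_mul, mul_comm m]
  congr 1
  ring

theorem div_two_pow_succ_le {r : ℝ} (hr : 0 ≤ r) (i : ℕ) : r / 2 ^ (i + 1) ≤ r / 2 := by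
  gcongr
  exact le_self_pow₀ one_le_two i.succ_ne_zero

theorem pairwise_disjoint_ball_dyadic {E : Type*} [NormedAddCommGroup E] [NormedSpace ℝ E] {e : E}
    (he : ‖e‖ = 1) {r τ : ℝ} (hr : 0 < r) (hτ : τ ≤ 1 / 4) :
    Pairwise (Function.onFun Disjoint fun i : ℕ =>
      Metric.ball (-(r / 2 ^ (i + 1)) • e) (τ * (r / 2 ^ (i + 1)))) := by
  refine (pairwise_disjoint_on _).2 fun i j hij => Metric.ball_disjoint_ball ?_
  have hhalf : r / 2 ^ (j + 1) ≤ r / 2 ^ (i + 1) / 2 := by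
    rw [div_div, ← pow_succ]
    gcongr
    exacts [one_le_two, hij]
  have hpos : 0 < r / 2 ^ (j + 1) := by positivity
  rw [dist_eq_norm, ← sub_smul, norm_smul, he, mul_one, Real.norm_eq_abs]
  refine le_trans ?_ (neg_le_abs _)
  nlinarith

theorem nat_mul_le_lintegral_of_dyadic {e : Eu m} (he : ‖e‖ = 1) {r τ : ℝ} (hr : 0 < r)
    (hτ : τ ≤ 1 / 4) {F : Eu m → ℝ≥0∞} {b : ℝ≥0∞} {N : ℕ}
    (h : ∀ i < N, b ≤ ∫⁻ z in Metric.ball (-(r / 2 ^ (i + 1)) • e) (τ * (r / 2 ^ (i + 1))), F z) :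
    N * b ≤ ∫⁻ z in Metric.ball 0 r, F z := by
  calc (N : ℝ≥0∞) * b = ∑ _i ∈ Finset.range N, b := by simp
    _ ≤ ∑ i ∈ Finset.range N,
          ∫⁻ z in Metric.ball (-(r / 2 ^ (i + 1)) • e) (τ * (r / 2 ^ (i + 1))), F z :=
        Finset.sum_le_sum fun i hi => h i (Finset.mem_range.1 hi)
    _ = ∫⁻ z in ⋃ i ∈ Finset.range N,
          Metric.ball (-(r / 2 ^ (i + 1)) • e) (τ * (r / 2 ^ (i + 1))), F z :=
        (lintegral_biUnion_finset
          ((pairwise_disjoint_ball_dyadic he hr hτ).set_pairwise _)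
          (fun _ _ => measurableSet_ball) F).symm
    _ ≤ ∫⁻ z in Metric.ball 0 r, F z :=
        lintegral_mono_set (iUnion₂_subset fun i _ =>
          ball_neg_smul_subset he hτ (by positivity) (div_two_pow_succ_le hr.le i))

theorem eventually_lt_pairEnergy_of_transversal [NeZero m]
    (hne : LinearMap.range LA.toLinearMap ≠ LinearMap.range LB.toLinearMap) (C : ℝ≥0) :
    ∀ᶠ ε in 𝓝[>] (0 : ℝ), ∀ q r S c s GA GB, SheetPair LA LB q r ε S c s GA GB →
      (C : ℝ≥0∞) < pairEnergy m S c := by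
  obtain ⟨e, he⟩ := exists_norm_eq (Eu m) zero_le_one
  obtain ⟨τ, ⟨hτ, hτ₄⟩, b, hb, hscale⟩ := exists_le_lintegral_of_transversal hne he
  obtain ⟨N, hN⟩ := ENNReal.exists_nat_mul_gt hb (b := 4 ^ m * C) (by finiteness)
  filter_upwards [hscale, self_mem_nhdsWithin,
    eventually_nhdsGT_zero_lt (f := fun ε => 4 * ε * 2 ^ N) (by fun_prop) (by simpa using hτ),
    eventually_nhdsGT_zero_lt continuous_id one_half_pos]
    with ε hscale hε hsmall hhalf q r S c s GA GB h
  have hε : 0 < ε := hε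
  have hr := h.flatA.radius_pos
  have hεR : ∀ i < N, 4 * ε * r ≤ τ * (r / 2 ^ (i + 1)) := fun i hi => by
    rw [← mul_div_assoc, le_div_iff₀ (by positivity), mul_right_comm]
    gcongr
    refine le_trans ?_ hsmall.le
    gcongr
    exacts [one_le_two, hi]
  refine h.lt_pairEnergy (le_of_lt hhalf) (hN.trans_le ?_)
  exact nat_mul_le_lintegral_of_dyadic he hr hτ₄ fun i hi =>
    hscale q r S c s GA GB h _ (by positivity) (div_two_pow_succ_le hr.le i) (hεR i hi)

end Transversal

section Tangential

open scoped InnerProduct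

variable {m n : ℕ} {L : Eu m →ₗᵢ[ℝ] Eu n} {q : Eu n} {r ε : ℝ}

theorem adjoint_toContinuousLinearMap_apply (L : Eu m →ₗᵢ[ℝ] Eu n) (v : Eu m) :
    (L.toContinuousLinearMap†) (L v) = v :=
  ext_inner_left ℝ fun w => by
    rw [ContinuousLinearMap.adjoint_inner_right]
    exact L.inner_map_map w v

theorem NearlyFlat.exists_adjoint_eq {G : Eu m → Eu n} (h : NearlyFlat L q r ε G) (hε₀ : 0 ≤ ε)
    (hε : ε ≤ 1 / 24) {y : Eu m} (hy : ‖y - (L.toContinuousLinearMap†) q‖ ≤ r / 3) :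
    ∃ z ∈ Metric.closedBall (0 : Eu m) (r / 2), (L.toContinuousLinearMap†) (G z) = y := by
  have hr := h.radius_pos
  have happrox : ApproximatesLinearOn (fun z => (L.toContinuousLinearMap†) (G z))
      (ContinuousLinearMap.id ℝ (Eu m)) (Metric.ball 0 r) ⟨ε, hε₀⟩ := by
    intro a ha b hb
    have := norm_adjoint_apply_le L (G a - G b - L (a - b))
    rw [map_sub, map_sub, adjoint_toContinuousLinearMap_apply] at this
    exact this.trans (h.norm_image_sub_le hb ha)
  let rightInv : (ContinuousLinearMap.id ℝ (Eu m)).NonlinearRightInverse :=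
    { toFun := id, nnnorm := 1, bound' := fun y => by simp, right_inv' := fun y => rfl }
  exact happrox.surjOn_closedBall_of_nonlinearRightInverse
    rightInv (b := 0) (half_pos hr).le
    (Metric.closedBall_subset_ball (half_lt_self hr)) (a := y) <| by
      rw [mem_closedBall_iff_norm, ← sub_add_sub_cancel y ((L.toContinuousLinearMap†) q)]
      have := norm_adjoint_apply_le L (q - G 0)
      rw [map_sub, norm_sub_rev q] at this
      refine (norm_add_le_of_le hy (this.trans h.norm_base_le)).trans ?_
      simp only [rightInv, inv_one, NNReal.coe_one]
      change r / 3 + ε * r ≤ (1 - ε) * (r / 2)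
      nlinarith

theorem SheetPair.exists_normal_point {S : Set (Eu n)} {c : Eu n → Eu n → ℝ} {s : ℝ}
    {GA GB : Eu m → Eu n} (h : SheetPair L L q r ε S c s GA GB) (hε₀ : 0 ≤ ε) (hε : ε ≤ 1 / 24)
    {z : Eu m} (hz : z ∈ Metric.ball 0 (r / 4)) :
    ∃ z₀ ∈ Metric.closedBall (0 : Eu m) (r / 2),
      (∀ v, inner ℝ (L v) (GB z₀ - GA z) = (0 : ℝ)) ∧ ‖GB z₀ - GA z‖ ≤ 4 * ε * r := by
  have hr := h.flatA.radius_pos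
  have hzr : z ∈ Metric.ball 0 r := Metric.ball_subset_ball (by linarith) hz
  have hA := h.flatA.norm_offset_le hε₀ hzr
  obtain ⟨z₀, hz₀, hproj⟩ := h.flatB.exists_adjoint_eq hε₀ hε
    (y := (L.toContinuousLinearMap†) (GA z)) <| by
      rw [← map_sub]
      refine (norm_adjoint_apply_le L _).trans ?_
      have := norm_sub_norm_le (GA z - q) (L z)
      rw [L.norm_map] at this
      nlinarith [mem_ball_zero_iff.1 hz]
  have hnormal : ∀ v, inner ℝ (L v) (GB z₀ - GA z) = (0 : ℝ) := fun v => by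
    have := ContinuousLinearMap.adjoint_inner_right L.toContinuousLinearMap v (GB z₀ - GA z)
    rw [map_sub, hproj, sub_self, inner_zero_right] at this
    exact this.symm
  refine ⟨z₀, hz₀, hnormal, ?_⟩
  have hB := h.flatB.norm_offset_le hε₀
    (Metric.closedBall_subset_ball (half_lt_self hr) hz₀)
  have hpyth := norm_sub_sq_eq_norm_sq_add_norm_sq_real
    ((real_inner_comm _ _).trans (hnormal (z₀ - z)))
  have hle : ‖GB z₀ - GA z - L (z₀ - z)‖ ≤ 2 * ε * r + 2 * ε * r := by
    refine le_of_eq_of_le (congrArg norm ?_) (norm_sub_le_of_le hB hA)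
    rw [map_sub]
    abel
  nlinarith [norm_nonneg (GB z₀ - GA z), norm_nonneg (GB z₀ - GA z - L (z₀ - z)),
    mul_self_nonneg ‖L (z₀ - z)‖]

theorem NearlyFlat.norm_sub_sub_smul_le {G : Eu m → Eu n} (h : NearlyFlat L q r ε G) (hε₀ : 0 ≤ ε)
    {a z z₀ : Eu m} {τ u : ℝ} (hu : 0 ≤ u) (hε : ε * (‖a‖ + τ) ≤ τ)
    (hz : z ∈ Metric.ball 0 r) (hz₀ : z₀ ∈ Metric.ball 0 r)
    (hd : ‖z - (z₀ + u • a)‖ ≤ τ * u) : ‖G z - G z₀ - u • L a‖ ≤ 2 * τ * u := by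
  have hflat := h.norm_image_sub_le hz₀ hz
  have hsub : ‖z - z₀‖ ≤ (‖a‖ + τ) * u := by
    have := norm_sub_norm_le (z - z₀) (u • a)
    rw [sub_sub, norm_smul, Real.norm_of_nonneg hu] at this
    linarith
  calc ‖G z - G z₀ - u • L a‖
      = ‖(G z - G z₀ - L (z - z₀)) + L (z - (z₀ + u • a))‖ := by
        simp only [map_sub, map_add, map_smul]
        congr 1
        abel
    _ ≤ ε * ((‖a‖ + τ) * u) + τ * u :=
        norm_add_le_of_le (hflat.trans (by gcongr)) (by rwa [L.norm_map])
    _ ≤ 2 * τ * u := by nlinarith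

theorem NearlyFlat.norm_sub_le {G : Eu m → Eu n} (h : NearlyFlat L q r ε G) (hε₀ : 0 ≤ ε)
    {a : Eu m} {u τ : ℝ} (hu : 0 ≤ u) (hετ : ε * (‖a‖ + τ) ≤ τ) {z z₀ : Eu m}
    (hz : z ∈ Metric.ball 0 r) (hz₀ : z₀ ∈ Metric.ball 0 r)
    (hd : ‖z - (z₀ + u • a)‖ ≤ τ * u) {y : Eu n} (hy : ‖G z₀ - y‖ ≤ u) :
    ‖G z - y‖ ≤ (2 * τ + 1 + ‖a‖) * u := by
  calc ‖G z - y‖ = ‖(G z - G z₀ - u • L a) + (G z₀ - y) + u • L a‖ := by congr 1; abel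
    _ ≤ 2 * τ * u + u + u * ‖a‖ :=
        norm_add_le_of_le (norm_add_le_of_le
          (h.norm_sub_sub_smul_le hε₀ hu hετ hz hz₀ hd) hy)
          (by rw [norm_smul, L.norm_map, Real.norm_of_nonneg hu])
    _ = (2 * τ + 1 + ‖a‖) * u := by ring

theorem eventually_mul_lt (x : ℝ) {b : ℝ} (hb : 0 < b) : ∀ᶠ ε in 𝓝[>] (0 : ℝ), ε * x < b :=
  eventually_nhdsGT_zero_lt (continuous_mul_const x) (by rwa [zero_mul])

/-- A patch of the sheet `GB` on which the angle is not acute: it is centred at the foot point of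
`GA z` on `GB`, displaced by `‖GB z₀ - GA z‖ • a` in the parameter domain, and its radius is
`τ * ‖GB z₀ - GA z‖`. The displacement is `0` if the sheets are equally oriented; otherwise it is so
large compared with the distance of the sheets that the chord is almost tangential. -/
def HasObtusePatch (L : Eu m →ₗᵢ[ℝ] Eu n) (r : ℝ) (c : Eu n → Eu n → ℝ) (GA GB : Eu m → Eu n)
    (a : Eu m) (τ : ℝ) : Prop :=
  ∀ z ∈ Metric.ball 0 r, ∀ z₀ ∈ Metric.ball 0 r,
    (∀ v, inner ℝ (L v) (GB z₀ - GA z) = (0 : ℝ)) → ∀ z' ∈ Metric.ball 0 r,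
      ‖z' - (z₀ + ‖GB z₀ - GA z‖ • a)‖ ≤ τ * ‖GB z₀ - GA z‖ → c (GA z) (GB z') ≤ 0

theorem exists_hasObtusePatch_one (L : Eu m →ₗᵢ[ℝ] Eu n) :
    ∃ (a : Eu m), ∃ τ > 0, ∀ᶠ ε in 𝓝[>] (0 : ℝ), ∀ q r S c GA GB,
      SheetPair L L q r ε S c 1 GA GB → HasObtusePatch L r c GA GB a τ := by
  obtain ⟨δ, hδ, hangle⟩ := exists_angleCos_neg_of_normal L
  refine ⟨0, δ / 3, by positivity, ?_⟩
  filter_upwards [eventually_mul_lt _ (show 0 < δ / 3 by positivity), Ioo_mem_nhdsGT hδ]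
    with ε hsmall hε q r S c GA GB h z hz z₀ hz₀ hnormal z' hz' hd
  have hν : 0 < ‖GB z₀ - GA z‖ := norm_pos_iff.2 (sub_ne_zero.2 (h.ne z hz z₀ hz₀).symm)
  have hdisp := h.flatB.norm_sub_sub_smul_le hε.1.le hν.le hsmall.le hz' hz₀ hd
  rw [h.angle z hz z' hz', one_mul]
  refine (hangle _ _ _ (GB z₀ - GA z) ((h.flatA.norm_fderiv_sub_le z hz).trans_lt hε.2)
    ((h.flatB.norm_fderiv_sub_le z' hz').trans_lt hε.2) (norm_pos_iff.1 hν) hnormal ?_).le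
  rw [map_zero, smul_zero, sub_zero] at hdisp
  rw [sub_sub_sub_cancel_right]
  nlinarith

theorem exists_hasObtusePatch_neg_one [NeZero m] (L : Eu m →ₗᵢ[ℝ] Eu n) :
    ∃ (a : Eu m), ∃ τ > 0, ∀ᶠ ε in 𝓝[>] (0 : ℝ), ∀ q r S c GA GB,
      SheetPair L L q r ε S c (-1) GA GB → HasObtusePatch L r c GA GB a τ := by
  obtain ⟨e, he⟩ := exists_norm_eq (Eu m) zero_le_one
  obtain ⟨δ, hδ, hangle⟩ := exists_angleCos_pos_of_tangent L
    (norm_ne_zero_iff.1 (by rw [he]; exact one_ne_zero))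
  refine ⟨(4 / δ) • e, 1, one_pos, ?_⟩
  filter_upwards [eventually_mul_lt _ one_pos, Ioo_mem_nhdsGT hδ]
    with ε hsmall hε q r S c GA GB h z hz z₀ hz₀ _ z' hz' hd
  have hν : 0 < ‖GB z₀ - GA z‖ := norm_pos_iff.2 (sub_ne_zero.2 (h.ne z hz z₀ hz₀).symm)
  have hdisp := h.flatB.norm_sub_sub_smul_le hε.1.le hν.le hsmall.le hz' hz₀ hd
  rw [h.angle z hz z' hz', neg_one_mul]
  refine neg_nonpos.2 (hangle _ _ _ (‖GB z₀ - GA z‖ * (4 / δ))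
    ((h.flatA.norm_fderiv_sub_le z hz).trans_lt hε.2)
    ((h.flatB.norm_fderiv_sub_le z' hz').trans_lt hε.2) (by positivity) ?_).le
  calc ‖GB z' - GA z - (‖GB z₀ - GA z‖ * (4 / δ)) • L e‖
      = ‖(GB z' - GB z₀ - ‖GB z₀ - GA z‖ • L ((4 / δ) • e)) + (GB z₀ - GA z)‖ := by
        rw [map_smul, smul_smul]
        congr 1
        abel
    _ ≤ 2 * 1 * ‖GB z₀ - GA z‖ + ‖GB z₀ - GA z‖ := norm_add_le_of_le hdisp le_rfl
    _ < δ * (‖GB z₀ - GA z‖ * (4 / δ)) := by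
        rw [mul_left_comm, mul_div_cancel₀ _ hδ.ne']
        linarith

theorem exists_hasObtusePatch [NeZero m] (L : Eu m →ₗᵢ[ℝ] Eu n) {s : ℝ} (hs : |s| = 1) :
    ∃ (a : Eu m), ∃ τ > 0, ∀ᶠ ε in 𝓝[>] (0 : ℝ), ∀ q r S c GA GB,
      SheetPair L L q r ε S c s GA GB → HasObtusePatch L r c GA GB a τ := by
  rcases eq_or_eq_neg_of_abs_eq hs with rfl | rfl
  exacts [exists_hasObtusePatch_one L, exists_hasObtusePatch_neg_one L]

theorem SheetPair.le_lintegral_of_hasObtusePatch [NeZero m] {S : Set (Eu n)} {c : Eu n → Eu n → ℝ}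
    {s : ℝ} {GA GB : Eu m → Eu n} (h : SheetPair L L q r ε S c s GA GB) (hε₀ : 0 < ε)
    (hε : ε ≤ 1 / 24) {a : Eu m} {τ : ℝ} (hτ : 0 < τ) (hετ : ε * (‖a‖ + τ) ≤ τ)
    (hεr : ε * (8 * (‖a‖ + τ)) ≤ 1)
    (hangle : HasObtusePatch L r c GA GB a τ) {z : Eu m} (hz : z ∈ Metric.ball 0 (r / 4)) :
    ENNReal.ofReal ((τ / (2 * τ + 1 + ‖a‖) ^ 2 / (4 * ε * r)) ^ m *
        volume.real (Metric.ball (0 : Eu m) 1)) ≤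
      ∫⁻ z' in Metric.ball 0 r, energyDensity m c (GA z) (GB z') := by
  have hr := h.flatA.radius_pos
  obtain ⟨z₀, hz₀, hnormal, hν⟩ := h.exists_normal_point hε₀.le hε hz
  have hz₀r := Metric.closedBall_subset_ball (half_lt_self hr) hz₀
  have hzr : z ∈ Metric.ball 0 r := Metric.ball_subset_ball (by linarith) hz
  have hpos : 0 < ‖GB z₀ - GA z‖ := norm_pos_iff.2 (sub_ne_zero.2 (h.ne z hzr z₀ hz₀r).symm)
  have hobtuse := hangle z hzr z₀ hz₀r hnormal
  generalize hu : ‖GB z₀ - GA z‖ = u at hobtuse hν hpos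
  have hsub : Metric.ball (z₀ + u • a) (τ * u) ⊆ Metric.ball 0 r := by
    refine Metric.ball_subset_ball' ?_
    rw [dist_zero_right]
    have := norm_add_le_of_le (mem_closedBall_zero_iff.1 hz₀) (norm_smul u a).le
    rw [Real.norm_of_nonneg hpos.le] at this
    nlinarith [norm_nonneg a]
  have hpoint : ∀ z' ∈ Metric.ball (z₀ + u • a) (τ * u),
      ENNReal.ofReal (1 ^ m / ((2 * τ + 1 + ‖a‖) * u) ^ (2 * m)) ≤
        energyDensity m c (GA z) (GB z') := fun z' hz' => by
    have hzr' := hsub hz'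
    rw [mem_ball_iff_norm] at hz'
    refine ofReal_le_energyDensity zero_le_one (le_sub_self_iff 1 |>.2 (hobtuse z' hzr' hz'.le))
      (h.ne z hzr z' hzr') ?_
    rw [dist_comm, dist_eq_norm]
    exact h.flatB.norm_sub_le hε₀.le hpos.le hετ hzr' hz₀r hz'.le hu.le
  refine le_trans (ENNReal.ofReal_le_ofReal ?_)
    ((ofReal_mul_volume_ball_le_setLIntegral (mul_pos hτ hpos) (by positivity) hpoint).trans
      (lintegral_mono_set hsub))
  calc (τ / (2 * τ + 1 + ‖a‖) ^ 2 / (4 * ε * r)) ^ m * volume.real (Metric.ball (0 : Eu m) 1)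
      ≤ (τ / (2 * τ + 1 + ‖a‖) ^ 2 / u) ^ m * volume.real (Metric.ball (0 : Eu m) 1) := by
        gcongr
    _ = _ := by
        rw [pow_mul, ← div_pow, ← mul_assoc, ← mul_pow]
        congr 2
        field_simp

theorem eventually_lt_pairEnergy_of_tangential [NeZero m] (L : Eu m →ₗᵢ[ℝ] Eu n) {s : ℝ}
    (hs : |s| = 1) (C : ℝ≥0) :
    ∀ᶠ ε in 𝓝[>] (0 : ℝ), ∀ q r S c GA GB, SheetPair L L q r ε S c s GA GB →
      (C : ℝ≥0∞) < pairEnergy m S c := by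
  obtain ⟨a, τ, hτ, hangle⟩ := exists_hasObtusePatch L hs
  have hΩ := volume_real_unit_ball_pos (m := m)
  filter_upwards [hangle, self_mem_nhdsWithin, eventually_mul_lt (‖a‖ + τ) hτ,
    eventually_mul_lt (8 * (‖a‖ + τ)) one_pos,
    eventually_nhdsGT_zero_lt continuous_id (b := 1 / 24) (by simp),
    eventually_nhdsGT_zero_lt (f := fun ε => (64 * ε) ^ m * C)
      (b := (τ / (2 * τ + 1 + ‖a‖) ^ 2) ^ m * volume.real (Metric.ball (0 : Eu m) 1) ^ 2)
      (by fun_prop) (by simp only [mul_zero, zero_pow (NeZero.ne m), zero_mul]; positivity)]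
    with ε hangle hε₀ hετ hεr hε hC q r S c GA GB h
  have hε₀ : 0 < ε := hε₀
  have hr := h.flatA.radius_pos
  refine h.lt_pairEnergy (le_trans (le_of_lt hε) (by norm_num)) ?_
  refine lt_of_lt_of_le ?_ ((ofReal_mul_volume_ball_le_setLIntegral (z := 0)
    (show 0 < r / 4 by positivity) (by positivity) fun z hz =>
      h.le_lintegral_of_hasObtusePatch hε₀ (le_of_lt hε) hτ hετ.le hεr.le
        (hangle q r S c GA GB h) hz).trans
    (lintegral_mono_set (Metric.ball_subset_ball (by linarith))))
  have hconst : (4 : ℝ≥0∞) ^ m * C = ENNReal.ofReal (4 ^ m * C) := by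
    rw [ENNReal.ofReal_mul (by positivity), ENNReal.ofReal_pow (by norm_num),
      ENNReal.ofReal_ofNat, ENNReal.ofReal_coe_nnreal]
  rw [hconst]
  refine (ENNReal.ofReal_lt_ofReal_iff (by positivity)).2 ?_
  calc (4 : ℝ) ^ m * C = (64 * ε) ^ m * C / (16 * ε) ^ m := by
        rw [mul_div_right_comm, ← div_pow]
        congr 2
        field_simp
        norm_num
    _ < (τ / (2 * τ + 1 + ‖a‖) ^ 2) ^ m * volume.real (Metric.ball (0 : Eu m) 1) ^ 2 /
          (16 * ε) ^ m := by gcongr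
    _ = _ := by
        rw [mul_mul_mul_comm, ← mul_pow, ← sq, mul_div_right_comm, ← div_pow]
        congr 2
        field_simp
        norm_num

theorem eventually_lt_pairEnergy [NeZero m] {LA LB : Eu m →ₗᵢ[ℝ] Eu n}
    (hL : LA = LB ∨ LinearMap.range LA.toLinearMap ≠ LinearMap.range LB.toLinearMap) (C : ℝ≥0) :
    ∀ᶠ ε in 𝓝[>] (0 : ℝ), ∀ q r S c s GA GB, SheetPair LA LB q r ε S c s GA GB →
      (C : ℝ≥0∞) < pairEnergy m S c := by
  rcases hL with rfl | hne
  · filter_upwards [eventually_lt_pairEnergy_of_tangential LA (abs_one (α := ℝ)) C,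
      eventually_lt_pairEnergy_of_tangential LA (s := -1) (by simp) C]
      with ε hpos hneg q r S c s GA GB h
    rcases eq_or_eq_neg_of_abs_eq h.abs_sign with rfl | rfl
    exacts [hpos q r S c GA GB h, hneg q r S c GA GB h]
  · exact eventually_lt_pairEnergy_of_transversal hne C

end Tangential

section Orientation

variable {m n : ℕ} {M : Type*} [TopologicalSpace M] [ChartedSpace (Eu m) M]

theorem finrank_tangentSpace (p : M) : Module.finrank ℝ (TangentSpace (𝓡 m) p) = m :=
  finrank_euclideanSpace_fin

instance (p : M) : FiniteDimensional ℝ (TangentSpace (𝓡 m) p) :=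
  inferInstanceAs (FiniteDimensional ℝ (Eu m))

/-- The coordinate vectors `∂ᵢψ(z)` of a parametrization `ψ`. -/
def coordVector (ψ : Eu m → M) (z : Eu m) (i : Fin m) : TangentSpace (𝓡 m) (ψ z) :=
  mfderiv (𝓡 m) (𝓡 m) ψ z (EuclideanSpace.single i 1 : Eu m)

/-- The differential of a parametrization, as an equivalence of vector spaces. -/
def mfderivEquiv {ψ : Eu m → M} {z : Eu m} (h : Function.Injective (mfderiv (𝓡 m) (𝓡 m) ψ z)) :
    Eu m ≃ₗ[ℝ] TangentSpace (𝓡 m) (ψ z) :=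
  (mfderiv (𝓡 m) (𝓡 m) ψ z).toLinearMap.linearEquivOfInjective h
    ((finrank_tangentSpace z).trans (finrank_tangentSpace (ψ z)).symm)

theorem mfderivEquiv_apply {ψ : Eu m → M} {z : Eu m}
    (h : Function.Injective (mfderiv (𝓡 m) (𝓡 m) ψ z)) (v : Eu m) :
    mfderivEquiv h v = mfderiv (𝓡 m) (𝓡 m) ψ z v :=
  rfl

theorem coe_map_mfderivEquiv {ψ : Eu m → M} {z : Eu m}
    (h : Function.Injective (mfderiv (𝓡 m) (𝓡 m) ψ z)) :
    ⇑((EuclideanSpace.basisFun (Fin m) ℝ).toBasis.map (mfderivEquiv h)) = coordVector ψ z :=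
  funext fun i => by
    rw [Module.Basis.map_apply, OrthonormalBasis.coe_toBasis, EuclideanSpace.basisFun_apply]
    exact mfderivEquiv_apply h _

variable [IsManifold (𝓡 m) 1 M]

/-- The coordinate vectors of the parametrization `ψ` form, at `z`, a basis of the orientation `o`
if `0 < s`, and of the opposite orientation if `s < 0`. -/
def IsCoordSign (o : MfdOrientation m M) (ψ : Eu m → M) (s : ℝ) (z : Eu m) : Prop :=
  ∀ β : Module.Basis (Fin m) ℝ (TangentSpace (𝓡 m) (ψ z)), β.orientation = o.at_ (ψ z) →
    0 < s * β.det (coordVector ψ z)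

variable {o : MfdOrientation m M} {ψ : Eu m → M} {s : ℝ} {z : Eu m}

theorem exists_basis_orientation_eq [NeZero m] (o : MfdOrientation m M) (p : M) :
    ∃ β : Module.Basis (Fin m) ℝ (TangentSpace (𝓡 m) p), β.orientation = o.at_ p :=
  ⟨_, Orientation.someBasis_orientation _ (by rw [finrank_tangentSpace, Fintype.card_fin])⟩

theorem isCoordSign_of_basis {β : Module.Basis (Fin m) ℝ (TangentSpace (𝓡 m) (ψ z))}
    (hβ : β.orientation = o.at_ (ψ z)) (h : 0 < s * β.det (coordVector ψ z)) :
    IsCoordSign o ψ s z := fun β' hβ' => by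
  have hpos := (Module.Basis.orientation_eq_iff_det_pos β' β).1 (hβ'.trans hβ.symm)
  rw [β'.det.eq_smul_basis_det β, AlternatingMap.smul_apply, smul_eq_mul, mul_left_comm]
  exact mul_pos hpos h

theorem isCoordSign_or_isCoordSign [NeZero m] (o : MfdOrientation m M)
    (hinj : Function.Injective (mfderiv (𝓡 m) (𝓡 m) ψ z)) :
    IsCoordSign o ψ 1 z ∨ IsCoordSign o ψ (-1) z := by
  obtain ⟨β, hβ⟩ := exists_basis_orientation_eq o (ψ z)
  have hdet : β.det (coordVector ψ z) ≠ 0 := by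
    rw [← coe_map_mfderivEquiv hinj]
    exact (β.isUnit_det _).ne_zero
  exact (lt_or_gt_of_ne hdet).symm.imp (fun h => isCoordSign_of_basis hβ (by rwa [one_mul]))
    fun h => isCoordSign_of_basis hβ (by rw [neg_one_mul]; exact neg_pos.2 h)

theorem IsCoordSign.neg_not [NeZero m] (h : IsCoordSign o ψ s z) : ¬ IsCoordSign o ψ (-s) z :=
  fun h' => by
  obtain ⟨β, hβ⟩ := exists_basis_orientation_eq o (ψ z)
  have := h' β hβ
  rw [neg_mul] at this
  exact (neg_pos.1 this).not_gt (h β hβ)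

theorem exists_equiv_eq_tangentCoordChange {p q : M} (hq : q ∈ (chartAt (Eu m) p).source) :
    ∃ e : TangentSpace (𝓡 m) p ≃ₗ[ℝ] TangentSpace (𝓡 m) q,
      ∀ v, e v = tangentCoordChange (𝓡 m) p q q v := by
  rw [← extChartAt_source (𝓡 m)] at hq
  have hq' := mem_extChartAt_source (I := 𝓡 m) q
  refine ⟨.ofLinearMap (tangentCoordChange (𝓡 m) p q q).toLinearMap
    (tangentCoordChange (𝓡 m) q p q).toLinearMap ?_ ?_, fun v => rfl⟩
  · ext1 v
    exact (tangentCoordChange_comp ⟨⟨hq', hq⟩, hq'⟩).trans (tangentCoordChange_self hq')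
  · ext1 v
    exact (tangentCoordChange_comp ⟨⟨hq, hq'⟩, hq⟩).trans (tangentCoordChange_self hq)

theorem coordVector_eq_tangentCoordChange {p : M} (hψ : MDifferentiableAt (𝓡 m) (𝓡 m) ψ z)
    (hz : ψ z ∈ (chartAt (Eu m) p).source) (i : Fin m) :
    coordVector ψ z i =
      tangentCoordChange (𝓡 m) p (ψ z) (ψ z) (stdFrame (fderiv ℝ (chartAt (Eu m) p ∘ ψ) z) i) := by
  rw [stdFrame, ← mfderiv_eq_fderiv,
    mfderiv_comp z (mdifferentiableAt_atlas (chart_mem_atlas _ p) hz) hψ,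
    mfderiv_chartAt_eq_tangentCoordChange hz]
  rw [← extChartAt_source (𝓡 m)] at hz
  have hz' := mem_extChartAt_source (I := 𝓡 m) (ψ z)
  exact ((tangentCoordChange_comp (I := 𝓡 m) ⟨⟨hz', hz⟩, hz'⟩).trans
    (tangentCoordChange_self hz')).symm

theorem IsCoordSign.eventually [NeZero m] (h : IsCoordSign o ψ s z)
    (hψ : ContMDiffAt (𝓡 m) (𝓡 m) 1 ψ z) : ∀ᶠ z' in 𝓝 z, IsCoordSign o ψ s z' := by
  obtain ⟨β, hβ⟩ := exists_basis_orientation_eq o (ψ z)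
  let b : Module.Basis (Fin m) ℝ (Eu m) := β
  let φ := chartAt (Eu m) (ψ z)
  have hφψ : ContDiffAt ℝ 1 (φ ∘ ψ) z := contMDiffAt_iff_contDiffAt.1
    ((contMDiffOn_chart.contMDiffAt (chart_source_mem_nhds _ _)).comp z hψ)
  have hcont : ContinuousAt (fun z' => s * b.det (stdFrame (fderiv ℝ (φ ∘ ψ) z'))) z := by
    have hfderiv : ContinuousAt (fderiv ℝ (φ ∘ ψ)) z :=
      (hφψ.fderiv_right (m := 0) le_rfl).continuousAt
    simp only [Module.Basis.det_apply]
    refine continuousAt_const.mul (continuous_id.matrix_det.continuousAt.comp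
      (continuousAt_pi.2 fun i => continuousAt_pi.2 fun j => ?_))
    exact (b.coord i).continuous_of_finiteDimensional.continuousAt.comp
      (hfderiv.clm_apply continuousAt_const)
  have hz : s * b.det (stdFrame (fderiv ℝ (φ ∘ ψ) z)) = s * β.det (coordVector ψ z) := by
    congr 2
    ext1 i
    rw [coordVector_eq_tangentCoordChange (hψ.mdifferentiableAt one_ne_zero)
      (mem_chart_source _ (ψ z)), tangentCoordChange_self (mem_extChartAt_source _)]
  filter_upwards [hcont.eventually (lt_mem_nhds ((h β hβ).trans_eq hz.symm)),
    hψ.continuousAt (chart_source_mem_nhds (Eu m) (ψ z)), hψ.continuousAt (o.locallyConst (ψ z)),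
    (contMDiffAt_iff_contMDiffAt_nhds (by simp)).1 hψ] with z' hpos hz' ho hψ'
  obtain ⟨e, he⟩ := exists_equiv_eq_tangentCoordChange hz'
  refine isCoordSign_of_basis (β := β.map e)
    ((ho β (β.map e) fun i => (β.map_apply e i).trans (he _)).1 hβ) ?_
  rw [Module.Basis.det_map]
  have hcoord : e.symm ∘ coordVector ψ z' = stdFrame (fderiv ℝ (φ ∘ ψ) z') := funext fun i =>
    e.symm_apply_eq.2 ((coordVector_eq_tangentCoordChange
      (hψ'.mdifferentiableAt one_ne_zero) hz' i).trans (he _).symm)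
  exact hpos.trans_eq (congrArg (fun v => s * β.det v) hcoord.symm)

theorem exists_forall_isCoordSign [NeZero m] (o : MfdOrientation m M) {U : Set (Eu m)}
    (hU : IsOpen U) (hUc : IsPreconnected U) (hψ : ContMDiffOn (𝓡 m) (𝓡 m) 1 ψ U)
    (hinj : ∀ z ∈ U, Function.Injective (mfderiv (𝓡 m) (𝓡 m) ψ z)) :
    ∃ s : ℝ, |s| = 1 ∧ ∀ z ∈ U, IsCoordSign o ψ s z := by
  let V (s : ℝ) : Set (Eu m) := {z | ∀ᶠ z' in 𝓝 z, IsCoordSign o ψ s z'}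
  have hV (s) : IsOpen (V s) := isOpen_setOfPred_eventually_nhds
  have hmem (s) : ∀ z ∈ U, IsCoordSign o ψ s z → z ∈ V s := fun z hz h =>
    h.eventually (hψ.contMDiffAt (hU.mem_nhds hz))
  have hcover : U ⊆ V 1 ∪ V (-1) := fun z hz =>
    (isCoordSign_or_isCoordSign o (hinj z hz)).imp (hmem _ z hz) (hmem _ z hz)
  have hdisj : U ∩ (V 1 ∩ V (-1)) = ∅ :=
    eq_empty_of_forall_notMem fun z hz => hz.2.1.self_of_nhds.neg_not hz.2.2.self_of_nhds
  rcases isPreconnected_iff_subset_of_disjoint.1 hUc _ _ (hV 1) (hV (-1)) hcover hdisj with h | h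
  · exact ⟨1, abs_one, fun z hz => (h hz).self_of_nhds⟩
  · exact ⟨-1, by simp, fun z hz => (h hz).self_of_nhds⟩

theorem exists_isPosFrame [NeZero m] {f : M → Eu n} (o : MfdOrientation m M) {p : M}
    (hf : Function.Injective (mfderiv (𝓡 m) (𝓡 n) f p)) : ∃ v, IsPosFrame f o (f p) v := by
  let A : TangentSpace (𝓡 m) p →ₗ[ℝ] Eu n := (mfderiv (𝓡 m) (𝓡 n) f p).toLinearMap
  let e := LinearEquiv.ofInjective A hf
  let v := ((o.at_ p).map (Fin m) e).finOrthonormalBasis (NeZero.pos m)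
    (e.finrank_eq.symm.trans (finrank_tangentSpace p))
  refine ⟨fun i => v i, v.orthonormal.comp_linearIsometry (LinearMap.range A).subtypeₗᵢ, p, rfl,
    v.toBasis.map e.symm, ?_, fun i => ?_⟩
  · rw [Module.Basis.orientation_map, Orientation.finOrthonormalBasis_orientation,
      ← Orientation.map_symm, Equiv.symm_apply_apply]
  · rw [Module.Basis.map_apply, OrthonormalBasis.coe_toBasis]
    exact (congrArg Subtype.val (e.apply_symm_apply (v i))).symm

theorem IsPosFrame.exists_eq_stdFrame {f : M → Eu n} (hs : IsCoordSign o ψ s z)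
    (hψ : MDifferentiableAt (𝓡 m) (𝓡 m) ψ z)
    (hψi : Function.Injective (mfderiv (𝓡 m) (𝓡 m) ψ z))
    (hf : MDifferentiableAt (𝓡 m) (𝓡 n) f (ψ z)) (hfi : Function.Injective f) {v : Fin m → Eu n}
    (hv : IsPosFrame f o (f (ψ z)) v) :
    ∃ Φ : Eu m →L[ℝ] Eu m, 0 < s * Φ.det ∧ v = stdFrame (fderiv ℝ (f ∘ ψ) z ∘L Φ) := by
  obtain ⟨-, p, hp, β, hβ, hvβ⟩ := hv
  obtain rfl : p = ψ z := hfi hp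
  let b := (EuclideanSpace.basisFun (Fin m) ℝ).toBasis
  let D := mfderivEquiv hψi
  let Φ : Eu m →ₗ[ℝ] Eu m := b.constr ℝ (D.symm ∘ β)
  have hΦ : Φ ∘ b = D.symm ∘ β := funext (b.constr_basis ℝ _)
  have hΦdet : (b.map D).det β = LinearMap.det Φ := by
    rw [Module.Basis.det_map, ← hΦ, Module.Basis.det_comp, Module.Basis.det_self, mul_one]
  have hmul : LinearMap.det Φ * β.det (coordVector ψ z) = 1 := by
    rw [← hΦdet, ← coe_map_mfderivEquiv hψi, Module.Basis.det_mul_det, Module.Basis.det_self]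
  have hpos := hs β hβ
  refine ⟨Φ.toContinuousLinearMap, ?_, funext fun i => ?_⟩
  · change 0 < s * LinearMap.det Φ
    have hs0 : 0 < s * s := mul_self_pos.2 (left_ne_zero_of_mul hpos.ne')
    refine pos_of_mul_pos_left (b := s * β.det (coordVector ψ z)) ?_ hpos.le
    rwa [mul_mul_mul_comm, hmul, mul_one]
  · have hi : mfderiv (𝓡 m) (𝓡 m) ψ z (Φ (EuclideanSpace.single i 1)) = β i := by
      have := congrFun hΦ i
      rw [Function.comp_apply, Function.comp_apply, LinearEquiv.eq_symm_apply] at this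
      rw [← this, OrthonormalBasis.coe_toBasis, EuclideanSpace.basisFun_apply]
      rfl
    rw [hvβ, stdFrame, ← mfderiv_eq_fderiv, mfderiv_comp z hf hψ, ← hi]
    rfl

theorem cosCombinedAngle_eq [NeZero m] {f : M → Eu n} {x y : Eu n} (hxy : x ≠ y)
    {A B : Eu m →L[ℝ] Eu n} {t : ℝ} (hs : |s| = 1) (ht : |t| = 1)
    (hx : ∃ v, IsPosFrame f o x v) (hy : ∃ v, IsPosFrame f o y v)
    (hA : ∀ v, IsPosFrame f o x v → ∃ Φ : Eu m →L[ℝ] Eu m, 0 < s * Φ.det ∧ v = stdFrame (A ∘L Φ))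
    (hB : ∀ v, IsPosFrame f o y v → ∃ Φ : Eu m →L[ℝ] Eu m, 0 < t * Φ.det ∧ v = stdFrame (B ∘L Φ)) :
    cosCombinedAngle f o x y = s * t * angleCos A B (y - x) := by
  obtain ⟨a₀, ha₀⟩ := hx
  obtain ⟨v₀, hv₀⟩ := hy
  obtain ⟨u₀, hu₀⟩ := exists_isPosSphereFrame (NeZero.pos m) ha₀.1 hxy
  obtain ⟨a, u, v, ha, hu, hv, hcos⟩ := Classical.epsilon_spec
    (p := fun t : ℝ => ∃ a u v : Fin m → Eu n, IsPosFrame f o x a ∧ IsPosSphereFrame x a y u ∧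
      IsPosFrame f o y v ∧ t = (gram u v).det) ⟨_, a₀, u₀, v₀, ha₀, hu₀, hv₀, rfl⟩
  obtain ⟨Φ, hΦ, rfl⟩ := hA a ha
  obtain ⟨Ψ, hΨ, rfl⟩ := hB v hv
  rw [cosCombinedAngle, hcos, hu.det_gram ha.1 hxy,
    neg_det_gram_eq_angleCos ha.1 hv.1 hs ht hΦ hΨ]

end Orientation

section Quotient

variable {m n : ℕ} {k : WithTop ℕ∞} {q : ℕ} {M : Type*} [TopologicalSpace M] [ChartedSpace (Eu m) M]
  {N : Type*} [TopologicalSpace N] [ChartedSpace (Eu n) N]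

theorem transOpenPartialHomeomorph_mem_maximalAtlas [IsManifold (𝓡 m) k M]
    (χ : M ≃ₘ^k⟮𝓡 m, 𝓡 m⟯ M) {φ : OpenPartialHomeomorph M (Eu m)}
    (hφ : φ ∈ IsManifold.maximalAtlas (𝓡 m) k M) :
    χ.toHomeomorph.transOpenPartialHomeomorph φ ∈ IsManifold.maximalAtlas (𝓡 m) k M :=
  OpenPartialHomeomorph.mem_maximalAtlas_of_contMDiffOn _
    ((contMDiffOn_of_mem_maximalAtlas hφ).comp χ.contMDiff.contMDiffOn fun _ hp => hp)
    (χ.symm.contMDiff.comp_contMDiffOn (contMDiffOn_symm_of_mem_maximalAtlas hφ))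

theorem preimage_comp_weakNhd (χ : M ≃ₘ^k⟮𝓡 m, 𝓡 m⟯ M) (f : C^k⟮𝓡 m, M; 𝓡 n, N⟯)
    (φ : OpenPartialHomeomorph M (Eu m)) (ψ : OpenPartialHomeomorph N (Eu n)) (K : Set M) (ε : ℝ) :
    (fun g : C^k⟮𝓡 m, M; 𝓡 n, N⟯ => g.comp χ.toContMDiffMap) ⁻¹' weakNhd q f φ ψ K ε =
      weakNhd q (f.comp χ.symm.toContMDiffMap) (χ.symm.toHomeomorph.transOpenPartialHomeomorph φ) ψ
        (χ '' K) ε := by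
  set φ' := χ.symm.toHomeomorph.transOpenPartialHomeomorph φ
  have himage : φ' '' (χ '' K) = φ '' K := by
    rw [image_image]
    exact image_congr fun p _ => congrArg φ (χ.symm_apply_apply p)
  have hlocal : ψ ∘ f.comp χ.symm.toContMDiffMap ∘ φ'.symm = ψ ∘ f ∘ φ.symm :=
    funext fun z => congrArg (ψ ∘ f) (χ.symm_apply_apply (φ.symm z))
  ext g
  simp only [weakNhd, mem_preimage, mem_ofPred_eq]
  rw [himage, hlocal, mapsTo_image_iff]
  rfl

theorem continuous_comp_diffeomorph [IsManifold (𝓡 m) k M] (χ : M ≃ₘ^k⟮𝓡 m, 𝓡 m⟯ M) :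
    Continuous[weakTopology (n := n) k q M N, weakTopology (n := n) k q M N]
      fun f : C^k⟮𝓡 m, M; 𝓡 n, N⟯ => f.comp χ.toContMDiffMap := by
  let _ := weakTopology (m := m) (n := n) k q M N
  refine continuous_generateFrom_iff.2 ?_
  rintro _ ⟨f, φ, ψ, K, ε, hφ, hψ, hK, hKφ, hfK, hε, rfl⟩
  have hχ (p : M) : χ.symm (χ p) = p := χ.symm_apply_apply p
  refine TopologicalSpace.isOpen_generateFrom_of_mem ⟨_, _, ψ, _, ε,
    transOpenPartialHomeomorph_mem_maximalAtlas χ.symm hφ, hψ, hK.image χ.continuous,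
    mapsTo_image_iff.2 fun p hp => ?_, mapsTo_image_iff.2 fun p hp => ?_, hε,
    preimage_comp_weakNhd χ f φ ψ K ε⟩
  · exact mem_of_eq_of_mem (s := φ.source) (hχ p) (hKφ hp)
  · exact mem_of_eq_of_mem (s := ψ.source) (congrArg f (hχ p)) (hfK hp)

/-- The reparametrization `f ∘ χ` of an immersion `f` by a diffeomorphism `χ`. -/
def Imm.reparam (hk : k ≠ 0) (χ : M ≃ₘ^k⟮𝓡 m, 𝓡 m⟯ M) (f : Imm m n k q M) : Imm m n k q M :=
  ⟨f.1.comp χ.toContMDiffMap, fun p => by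
    have h := mfderiv_comp p (f.1.contMDiff.mdifferentiable hk (χ p)) (χ.mdifferentiable hk p)
    exact h ▸ (f.2 (χ p)).comp (χ.mfderivToContinuousLinearEquiv hk p).injective⟩

theorem continuous_reparam [IsManifold (𝓡 m) k M] (hk : k ≠ 0) (χ : M ≃ₘ^k⟮𝓡 m, 𝓡 m⟯ M) :
    Continuous (Imm.reparam hk χ : Imm m n k q M → Imm m n k q M) :=
  let _ := weakTopology (m := m) (n := n) k q M (Eu n)
  continuous_induced_rng.2 ((continuous_comp_diffeomorph χ).comp continuous_induced_dom)

theorem preimage_image_mk (hk : k ≠ 0) (U : Set (Imm m n k q M)) :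
    Quotient.mk (immSetoid m n k q M) ⁻¹' (Quotient.mk (immSetoid m n k q M) '' U) =
      ⋃ χ : M ≃ₘ^k⟮𝓡 m, 𝓡 m⟯ M, Imm.reparam hk χ ⁻¹' U := by
  ext g
  simp only [mem_preimage, mem_image, mem_iUnion]
  constructor
  · rintro ⟨f, hf, hfg⟩
    obtain ⟨χ, hχ⟩ := Quotient.exact hfg.symm
    exact ⟨χ, mem_of_eq_of_mem (Subtype.ext (ContMDiffMap.ext fun p => (hχ p).symm)) hf⟩
  · rintro ⟨χ, hχ⟩
    exact ⟨_, hχ, Quotient.sound (Setoid.symm ⟨χ, fun p => rfl⟩)⟩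

theorem isOpenMap_mk [IsManifold (𝓡 m) k M] (hk : k ≠ 0) :
    IsOpenMap (Quotient.mk (immSetoid m n k q M) : Imm m n k q M → ImmSubmfd m n k q M) := by
  intro U hU
  rw [← isQuotientMap_quotient_mk'.isOpen_preimage]
  exact (preimage_image_mk hk U).symm ▸
    isOpen_iUnion fun χ => (continuous_reparam hk χ).isOpen_preimage U hU

end Quotient

section Nearby

variable {m n : ℕ}

theorem opNorm_le_sum_stdFrame (A : Eu m →L[ℝ] Eu n) : ‖A‖ ≤ ∑ i, ‖stdFrame A i‖ := by
  refine A.opNorm_le_bound (Finset.sum_nonneg fun _ _ => norm_nonneg _) fun v => ?_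
  have hv : A v = ∑ i, v i • stdFrame A i := by
    conv_lhs => rw [← (EuclideanSpace.basisFun (Fin m) ℝ).sum_repr v]
    simp [stdFrame]
  rw [hv, Finset.sum_mul]
  refine norm_sum_le_of_le _ fun i _ => ?_
  rw [norm_smul, mul_comm]
  gcongr
  exact PiLp.norm_apply_le v i

theorem exists_isometry_range (T : Submodule ℝ (Eu n)) (hT : Module.finrank ℝ T = m) :
    ∃ L : Eu m →ₗᵢ[ℝ] Eu n, LinearMap.range L.toLinearMap = T := by
  let e := (stdOrthonormalBasis ℝ T).reindex (finCongr hT)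
  refine ⟨T.subtypeₗᵢ.comp e.repr.symm.toLinearIsometry, ?_⟩
  ext x
  constructor
  · rintro ⟨z, rfl⟩
    exact (e.repr.symm z).2
  · intro hx
    exact ⟨e.repr ⟨x, hx⟩, by simp⟩

theorem exists_equiv_comp_eq_of_range_eq {A L : Eu m →L[ℝ] Eu n} (hA : Function.Injective A)
    (hL : Function.Injective L)
    (h : LinearMap.range L.toLinearMap = LinearMap.range A.toLinearMap) :
    ∃ Q : Eu m ≃L[ℝ] Eu m, A ∘L Q = L := by
  let E := LinearEquiv.ofInjective A.toLinearMap hA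
  let F := LinearEquiv.ofInjective L.toLinearMap hL
  refine ⟨(F ≪≫ₗ LinearEquiv.ofEq _ _ h ≪≫ₗ E.symm).toContinuousLinearEquiv, ?_⟩
  ext1 z
  exact congrArg Subtype.val (E.apply_symm_apply (LinearEquiv.ofEq _ _ h (F z)))

variable {k : WithTop ℕ∞} {q : ℕ} {M : Type*} [TopologicalSpace M] [ChartedSpace (Eu m) M]

theorem mfderiv_eq_fderiv_chart (hk : k ≠ 0) (f : Imm m n k q M) (p : M) :
    (mfderiv (𝓡 m) (𝓡 n) f p : Eu m →L[ℝ] Eu n) =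
      fderiv ℝ (f ∘ (chartAt (Eu m) p).symm) (chartAt (Eu m) p p) := by
  have h : MDifferentiableAt (𝓡 m) (𝓡 n) f p := f.1.contMDiff.mdifferentiable hk p
  rw [h.mfderiv]
  simp [writtenInExtChartAt]
  rfl

variable {φ : OpenPartialHomeomorph M (Eu m)}

theorem contDiffOn_comp_chart_symm (hφ : φ ∈ IsManifold.maximalAtlas (𝓡 m) k M)
    (f : Imm m n k q M) : ContDiffOn ℝ k (f ∘ φ.symm) φ.target :=
  (f.1.contMDiff.comp_contMDiffOn (contMDiffOn_symm_of_mem_maximalAtlas hφ)).contDiffOn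

theorem eventually_chart_close (hq : 1 ≤ q) (hφ : φ ∈ IsManifold.maximalAtlas (𝓡 m) k M)
    (f : Imm m n k q M) {B : Set (Eu m)} (hB : IsCompact B) (hBt : B ⊆ φ.target) {η : ℝ}
    (hη : 0 < η) :
    ∀ᶠ g : Imm m n k q M in 𝓝 f, ∀ z ∈ B, ‖(g ∘ φ.symm) z - (f ∘ φ.symm) z‖ ≤ η ∧
      ‖fderiv ℝ (g ∘ φ.symm) z - fderiv ℝ (f ∘ φ.symm) z‖ ≤ η := by
  set δ := η / (m + 1)
  have hδ : 0 < δ := by positivity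
  have hδη : (m + 1) * δ = η := mul_div_cancel₀ η (by positivity)
  set U := weakNhd q f.1 φ (OpenPartialHomeomorph.refl (Eu n)) (φ.symm '' B) δ
  have hU : IsOpen ((fun g : Imm m n k q M => g.1) ⁻¹' U) := by
    let _ := weakTopology (m := m) (n := n) k q M (Eu n)
    exact isOpen_induced (TopologicalSpace.isOpen_generateFrom_of_mem ⟨f.1, φ, _, _, δ, hφ,
      StructureGroupoid.id_mem_maximalAtlas _, hB.image_of_continuousOn
        (φ.continuousOn_symm.mono hBt), mapsTo_iff_image_subset.1 (φ.mapsTo_symm.mono_left hBt),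
      fun _ _ => mem_univ _, hδ, rfl⟩)
  have hfU : f.1 ∈ U := ⟨fun _ _ => mem_univ _, fun _ _ _ _ _ => by rwa [sub_self, norm_zero]⟩
  filter_upwards [hU.mem_nhds hfU] with g hg z hz
  have hclose := hg.2 z ⟨φ.symm z, mem_image_of_mem _ hz, φ.right_inv (hBt hz)⟩
  constructor
  · have h := hclose 0 (Nat.zero_le _) Fin.elim0
    simp only [partialDeriv, iteratedFDeriv_zero_apply] at h
    exact h.le.trans (by nlinarith)
  · have h (i : Fin m) : ‖stdFrame (fderiv ℝ (g ∘ φ.symm) z - fderiv ℝ (f ∘ φ.symm) z) i‖ ≤ δ := by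
      have h := hclose 1 hq fun _ => i
      simp only [partialDeriv, iteratedFDeriv_one_apply] at h
      exact h.le
    calc _ ≤ ∑ _i : Fin m, δ := (opNorm_le_sum_stdFrame _).trans (Finset.sum_le_sum fun i _ => h i)
      _ = m * δ := by simp
      _ ≤ η := by linarith

theorem eventually_nearlyFlat (hk : k ≠ 0) (hq : 1 ≤ q)
    (hφ : φ ∈ IsManifold.maximalAtlas (𝓡 m) k M) {p : M} (hp : p ∈ φ.source) (hφp : φ p = 0)
    {f : Imm m n k q M} {L : Eu m →ₗᵢ[ℝ] Eu n}
    (hL : HasFDerivAt (f ∘ φ.symm) L.toContinuousLinearMap 0) {ε : ℝ} (hε : 0 < ε) :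
    ∀ᶠ r in 𝓝[>] (0 : ℝ), ∀ᶠ g : Imm m n k q M in 𝓝 f, NearlyFlat L (f p) r ε (g ∘ φ.symm) := by
  have htarget : φ.target ∈ 𝓝 (0 : Eu m) :=
    φ.open_target.mem_nhds (hφp ▸ φ.map_source hp)
  have hcont : ContinuousAt (fderiv ℝ (f ∘ φ.symm)) 0 :=
    (((contDiffOn_comp_chart_symm hφ f).contDiffAt htarget).fderiv_right (m := 0)
      (by simpa using ENat.one_le_iff_ne_zero_withTop.2 hk)).continuousAt
  have hclose : ∀ᶠ z in 𝓝 (0 : Eu m),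
      ‖fderiv ℝ (f ∘ φ.symm) z - L.toContinuousLinearMap‖ < ε / 2 := by
    simpa only [Metric.mem_ball, dist_eq_norm, hL.fderiv] using
      hcont.eventually (Metric.ball_mem_nhds _ (half_pos hε))
  have hsmall : ∀ᶠ r in 𝓝[>] (0 : ℝ), Metric.closedBall 0 r ⊆ φ.target ∩ _ :=
    ((tendsto_closedBall_smallSets 0).mono_left nhdsWithin_le_nhds).eventually
      (eventually_smallSets_subset.2 (inter_mem htarget hclose))
  filter_upwards [hsmall, self_mem_nhdsWithin] with r hr (hr0 : 0 < r)
  filter_upwards [eventually_chart_close hq hφ f (isCompact_closedBall 0 r)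
    (hr.trans inter_subset_left) (show 0 < min (ε * r) (ε / 2) by positivity)] with g hg
  refine ⟨hr0, fun z hz => ?_, fun z hz => ?_, ?_⟩
  · have hz' := (hr (Metric.ball_subset_closedBall hz)).1
    exact ((contDiffOn_comp_chart_symm hφ g).contDiffAt
      (φ.open_target.mem_nhds hz')).differentiableAt hk
  · have hz' := Metric.ball_subset_closedBall hz
    have hgf := (hg z hz').2.trans (min_le_right _ _)
    have hfL : ‖fderiv ℝ (f ∘ φ.symm) z - L.toContinuousLinearMap‖ < ε / 2 := (hr hz').2
    linarith [norm_sub_le_norm_sub_add_norm_sub (fderiv ℝ (g ∘ φ.symm) z)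
      (fderiv ℝ (f ∘ φ.symm) z) L.toContinuousLinearMap]
  · have hbase : φ.symm 0 = p := hφp ▸ φ.left_inv hp
    have h := (hg 0 (Metric.mem_closedBall_self hr0.le)).1.trans (min_le_left _ _)
    simpa only [Function.comp_apply, hbase] using h

variable [IsManifold (𝓡 m) k M]

theorem transHomeomorph_mem_maximalAtlas (hφ : φ ∈ IsManifold.maximalAtlas (𝓡 m) k M)
    {h : Eu m ≃ₜ Eu m} (hh : ContDiff ℝ k h) (hh' : ContDiff ℝ k h.symm) :
    φ.transHomeomorph h ∈ IsManifold.maximalAtlas (𝓡 m) k M :=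
  OpenPartialHomeomorph.mem_maximalAtlas_of_contMDiffOn _
    (hh.contMDiff.comp_contMDiffOn (contMDiffOn_of_mem_maximalAtlas hφ))
    ((contMDiffOn_symm_of_mem_maximalAtlas hφ).comp hh'.contMDiff.contMDiffOn fun _ hz => hz)

theorem exists_chart_hasFDerivAt (hk : k ≠ 0) (f : Imm m n k q M) (p : M) (L : Eu m →ₗᵢ[ℝ] Eu n)
    (hL : LinearMap.range L.toLinearMap = tangentPlane (m := m) f p) :
    ∃ φ ∈ IsManifold.maximalAtlas (𝓡 m) k M, p ∈ φ.source ∧ φ p = 0 ∧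
      HasFDerivAt (f ∘ φ.symm) L.toContinuousLinearMap 0 := by
  set φ := chartAt (Eu m) p
  have hφM : φ ∈ IsManifold.maximalAtlas (𝓡 m) k M := IsManifold.chart_mem_maximalAtlas p
  have hp : p ∈ φ.source := mem_chart_source _ p
  have hdf := mfderiv_eq_fderiv_chart hk f p
  obtain ⟨Q, hQ⟩ := exists_equiv_comp_eq_of_range_eq (L := L.toContinuousLinearMap)
    (hdf ▸ f.2 p) L.injective
    (hL.trans (congrArg (fun A : Eu m →L[ℝ] Eu n => LinearMap.range A.toLinearMap) hdf))
  let h : Eu m ≃ₜ Eu m := Q.toHomeomorph.trans (Homeomorph.addLeft (φ p))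
  have h0 : h 0 = φ p := by simp [h]
  have hh : ContDiff ℝ k h := contDiff_const.add Q.contDiff
  have hh' : ContDiff ℝ k h.symm := Q.symm.contDiff.comp (contDiff_const.add contDiff_id)
  refine ⟨φ.transHomeomorph h.symm, transHomeomorph_mem_maximalAtlas hφM hh' hh, hp,
    h.symm_apply_eq.2 h0.symm, ?_⟩
  have hf : DifferentiableAt ℝ (f ∘ φ.symm) (h 0) := h0 ▸
    ((contDiffOn_comp_chart_symm hφM f).contDiffAt
      (φ.open_target.mem_nhds (φ.map_source hp))).differentiableAt hk
  have hcomp := hf.hasFDerivAt.comp (0 : Eu m) (Q.hasFDerivAt.const_add (φ p))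
  rw [h0] at hcomp
  exact hQ ▸ hcomp

theorem exists_parametrization_nearlyFlat (hk : k ≠ 0) (hq : 1 ≤ q) (f : Imm m n k q M) (p : M)
    (L : Eu m →ₗᵢ[ℝ] Eu n) (hL : LinearMap.range L.toLinearMap = tangentPlane (m := m) f p)
    {W : Set M} (hW : W ∈ 𝓝 p) {ε : ℝ} (hε : 0 < ε) :
    ∃ ψ : Eu m → M, ∀ᶠ r in 𝓝[>] (0 : ℝ), MapsTo ψ (Metric.ball 0 r) W ∧
      ContMDiffOn (𝓡 m) (𝓡 m) k ψ (Metric.ball 0 r) ∧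
      ∀ᶠ g : Imm m n k q M in 𝓝 f, NearlyFlat L (f p) r ε (g ∘ ψ) := by
  obtain ⟨φ, hφ, hp, hφp, hfL⟩ := exists_chart_hasFDerivAt hk f p L hL
  have hW' : φ.target ∩ φ.symm ⁻¹' W ∈ 𝓝 (0 : Eu m) := hφp ▸
    inter_mem (φ.open_target.mem_nhds (φ.map_source hp))
      ((φ.continuousAt_symm (φ.map_source hp)).preimage_mem_nhds (by rwa [φ.left_inv hp]))
  have hsmall : ∀ᶠ r in 𝓝[>] (0 : ℝ), Metric.closedBall 0 r ⊆ φ.target ∩ φ.symm ⁻¹' W :=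
    ((tendsto_closedBall_smallSets 0).mono_left nhdsWithin_le_nhds).eventually
      (eventually_smallSets_subset.2 hW')
  refine ⟨φ.symm, ?_⟩
  filter_upwards [hsmall, eventually_nearlyFlat hk hq hφ hp hφp hfL hε] with r hr hflat
  have hball := Metric.ball_subset_closedBall.trans hr
  exact ⟨fun z hz => (hball hz).2, (contMDiffOn_symm_of_mem_maximalAtlas hφ).mono
    (hball.trans inter_subset_left), hflat⟩

end Nearby

section DoublePoint

variable {m n : ℕ} {L LA LB : Eu m →ₗᵢ[ℝ] Eu n} {x : Eu n} {r ε : ℝ}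

theorem NearlyFlat.injective_fderiv {G : Eu m → Eu n} (h : NearlyFlat L x r ε G) (hε : ε < 1)
    {z : Eu m} (hz : z ∈ Metric.ball 0 r) : Function.Injective (fderiv ℝ G z) := by
  refine (injective_iff_map_eq_zero _).2 fun v hv => ?_
  have hsub : (fderiv ℝ G z - L.toContinuousLinearMap) v = -L v := by
    rw [sub_apply, hv, zero_sub]
    rfl
  have hle := ContinuousLinearMap.le_of_opNorm_le _ (h.norm_fderiv_sub_le z hz) v
  rw [hsub, norm_neg, L.norm_map] at hle
  exact norm_le_zero_iff.1 (by nlinarith [norm_nonneg v])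

variable {M : Type*} [TopologicalSpace M] [ChartedSpace (Eu m) M] [IsManifold (𝓡 m) 1 M]

theorem NearlyFlat.exists_frame_sign [NeZero m] {g : M → Eu n} (hgd : MDifferentiable (𝓡 m) (𝓡 n) g)
    (hgi : ∀ p, Function.Injective (mfderiv (𝓡 m) (𝓡 n) g p)) (hg : Function.Injective g)
    (o : MfdOrientation m M) {ψ : Eu m → M}
    (hψ : ContMDiffOn (𝓡 m) (𝓡 m) 1 ψ (Metric.ball 0 r)) (h : NearlyFlat L x r ε (g ∘ ψ))
    (hε : ε < 1) :
    ∃ s : ℝ, |s| = 1 ∧ ∀ z ∈ Metric.ball 0 r, (∃ v, IsPosFrame g o (g (ψ z)) v) ∧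
      ∀ v, IsPosFrame g o (g (ψ z)) v → ∃ Φ : Eu m →L[ℝ] Eu m,
        0 < s * Φ.det ∧ v = stdFrame (fderiv ℝ (g ∘ ψ) z ∘L Φ) := by
  have hψd : ∀ z ∈ Metric.ball 0 r, MDifferentiableAt (𝓡 m) (𝓡 m) ψ z := fun z hz =>
    (hψ.contMDiffAt (Metric.isOpen_ball.mem_nhds hz)).mdifferentiableAt one_ne_zero
  have hψi : ∀ z ∈ Metric.ball 0 r, Function.Injective (mfderiv (𝓡 m) (𝓡 m) ψ z) := by
    intro z hz
    have hinj : Function.Injective (mfderiv (𝓡 m) (𝓡 n) (g ∘ ψ) z) := by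
      rw [mfderiv_eq_fderiv]
      exact h.injective_fderiv hε hz
    rw [mfderiv_comp z (hgd _) (hψd z hz)] at hinj
    exact Function.Injective.of_comp (f := mfderiv (𝓡 m) (𝓡 n) g (ψ z)) hinj
  obtain ⟨s, hs, hsign⟩ := exists_forall_isCoordSign o Metric.isOpen_ball
    (convex_ball (0 : Eu m) r).isPreconnected hψ hψi
  exact ⟨s, hs, fun z hz => ⟨exists_isPosFrame o (hgi _), fun v hv =>
    hv.exists_eq_stdFrame (hsign z hz) (hψd z hz) (hψi z hz) (hgd _) hg⟩⟩

theorem exists_sheetPair [NeZero m] {g : M → Eu n} (hgd : MDifferentiable (𝓡 m) (𝓡 n) g)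
    (hgi : ∀ p, Function.Injective (mfderiv (𝓡 m) (𝓡 n) g p)) (hg : Function.Injective g)
    (o : MfdOrientation m M) {ψA ψB : Eu m → M}
    (hψA : ContMDiffOn (𝓡 m) (𝓡 m) 1 ψA (Metric.ball 0 r))
    (hψB : ContMDiffOn (𝓡 m) (𝓡 m) 1 ψB (Metric.ball 0 r))
    (hA : NearlyFlat LA x r ε (g ∘ ψA)) (hB : NearlyFlat LB x r ε (g ∘ ψB)) (hε : ε < 1)
    (hne : ∀ z ∈ Metric.ball 0 r, ∀ z' ∈ Metric.ball 0 r, ψA z ≠ ψB z') :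
    ∃ s, SheetPair LA LB x r ε (range g) (cosCombinedAngle g o) s (g ∘ ψA) (g ∘ ψB) := by
  obtain ⟨s, hs, hsA⟩ := hA.exists_frame_sign hgd hgi hg o hψA hε
  obtain ⟨t, ht, htB⟩ := hB.exists_frame_sign hgd hgi hg o hψB hε
  have hne' : ∀ z ∈ Metric.ball 0 r, ∀ z' ∈ Metric.ball 0 r, g (ψA z) ≠ g (ψB z') :=
    fun z hz z' hz' => hg.ne (hne z hz z' hz')
  exact ⟨s * t, hA, hB, fun z _ => mem_range_self _, fun z _ => mem_range_self _, hne',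
    by rw [abs_mul, hs, ht, one_mul], fun z hz z' hz' => cosCombinedAngle_eq (hne' z hz z' hz')
      hs ht (hsA z hz).1 (htB z' hz').1 (hsA z hz).2 (htB z' hz').2⟩

variable {k : WithTop ℕ∞} {q : ℕ} [IsManifold (𝓡 m) k M] [T2Space M]

theorem exists_eventually_sheetPair [NeZero m] (hk : k ≠ 0) (hq : 1 ≤ q) {f : Imm m n k q M}
    {p p' : M} (hpp' : p ≠ p') (hf : f p = f p')
    (hLA : LinearMap.range LA.toLinearMap = tangentPlane (m := m) f p)
    (hLB : LinearMap.range LB.toLinearMap = tangentPlane (m := m) f p') (hε₀ : 0 < ε)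
    (hε : ε < 1) :
    ∃ r, ∀ᶠ N in 𝓝 (⟦f⟧ : ImmSubmfd m n k q M), ∀ g : Imm m n k q M, ⟦g⟧ = N →
      Function.Injective g → ∀ o : MfdOrientation m M, ∃ s GA GB,
        SheetPair LA LB (f p) r ε (range g) (cosCombinedAngle g o) s GA GB := by
  have hk₁ : 1 ≤ k := ENat.one_le_iff_ne_zero_withTop.2 hk
  obtain ⟨W, W', hW, hW', hpW, hpW', hWW'⟩ := t2_separation hpp'
  obtain ⟨ψA, hA⟩ := exists_parametrization_nearlyFlat hk hq f p LA hLA (hW.mem_nhds hpW) hε₀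
  obtain ⟨ψB, hB⟩ := exists_parametrization_nearlyFlat hk hq f p' LB hLB (hW'.mem_nhds hpW') hε₀
  obtain ⟨r, ⟨hAW, hψA, hflatA⟩, hBW, hψB, hflatB⟩ := (hA.and hB).exists
  refine ⟨r, (isOpenMap_mk hk).nhds_le f (Filter.mem_map.2 ?_)⟩
  filter_upwards [hflatA, hflatB] with g₀ hgA hgB g hg hinj o
  obtain ⟨χ, hχ⟩ := Quotient.exact hg
  have hcomp (ψ : Eu m → M) : (g₀ : M → Eu n) ∘ ψ = g ∘ (χ ∘ ψ) := funext fun z => hχ (ψ z)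
  have hχψ {ψ : Eu m → M} (hψ : ContMDiffOn (𝓡 m) (𝓡 m) k ψ (Metric.ball 0 r)) :
      ContMDiffOn (𝓡 m) (𝓡 m) 1 (χ ∘ ψ) (Metric.ball 0 r) :=
    (χ.contMDiff.comp_contMDiffOn hψ).of_le hk₁
  rw [hcomp] at hgA hgB
  obtain ⟨s, hs⟩ := exists_sheetPair (g.1.contMDiff.mdifferentiable hk) g.2 hinj o (hχψ hψA)
    (hχψ hψB) hgA (hf ▸ hgB) hε fun z hz z' hz' h =>
      hWW'.ne_of_mem (hAW hz) (hBW hz') (χ.injective h)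
  exact ⟨s, _, _, hs⟩

end DoublePoint

end

end KusnerSullivan

open KusnerSullivan in
theorem theorem2_general {m n : ℕ} (hm : 1 ≤ m) {k : WithTop ℕ∞} (hk : 1 ≤ k) {q : ℕ} (hq : 1 ≤ q)
    (M : Type*) [TopologicalSpace M] [T2Space M] [ChartedSpace (EuclideanSpace ℝ (Fin m)) M]
    [IsManifold (𝓡 m) 1 M] [IsManifold (𝓡 m) k M] (𝒞 : Set (ImmSubmfd m n k q M)) :
    SelfRepulsiveOn (energy (m := m) (n := n) (M := M)) 𝒞 := by
  rintro _ - ⟨f, rfl, p, p', hpp', hf⟩ C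
  have : NeZero m := ⟨by omega⟩
  have hk₀ : k ≠ 0 := ENat.one_le_iff_ne_zero_withTop.1 hk
  have hrank (p : M) : Module.finrank ℝ (tangentPlane (m := m) f p) = m :=
    (LinearMap.finrank_range_of_inj (f.2 p)).trans (finrank_tangentSpace p)
  obtain ⟨LA, hLA⟩ := exists_isometry_range _ (hrank p)
  obtain ⟨LB, hLB, hL⟩ : ∃ LB : Eu m →ₗᵢ[ℝ] Eu n,
      LinearMap.range LB.toLinearMap = tangentPlane (m := m) f p' ∧
        (LA = LB ∨ LinearMap.range LA.toLinearMap ≠ LinearMap.range LB.toLinearMap) := by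
    by_cases hT : tangentPlane (m := m) f p = tangentPlane (m := m) f p'
    · exact ⟨LA, hLA.trans hT, Or.inl rfl⟩
    · obtain ⟨LB, hLB⟩ := exists_isometry_range _ (hrank p')
      exact ⟨LB, hLB, Or.inr (hLA.trans_ne (hLB ▸ hT))⟩
  obtain ⟨ε, hlarge, hε₀, hε⟩ :=
    ((eventually_lt_pairEnergy hL C).and (Ioo_mem_nhdsGT one_pos)).exists
  obtain ⟨r, hr⟩ := exists_eventually_sheetPair hk₀ hq hpp' hf hLA hLB hε₀ hε
  filter_upwards [hr] with N hN g hg hemb o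
  obtain ⟨s, GA, GB, hpair⟩ := hN g hg hemb.injective o
  exact hlarge _ _ _ _ _ _ _ hpair

theorem theorem2 {m n : ℕ} (hm : 1 ≤ m)
    (M : Type*) [TopologicalSpace M] [CompactSpace M] [T2Space M]
    [ChartedSpace (EuclideanSpace ℝ (Fin m)) M] [IsManifold (𝓡 m) 2 M]
    (ε₀ b : ℝ) (hε₀ : 0 < ε₀) (hb : 0 < b) :
    KusnerSullivan.SelfRepulsiveOn (KusnerSullivan.energy (m := m) (n := n) (M := M))
      (KusnerSullivan.boundedGeometry m n 2 2 M ε₀ b ⊤) :=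
  theorem2_general hm one_le_two one_le_two M _
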